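/- Let $M$ be a smooth ($C^\infty$) Hausdorff manifold without boundary of dimension $n$, and let $g,\bar g$ be smooth Riemannian metrics on $M$. Suppose that $g$ and $\bar g$ are geodesically equivalent, i.e. that they have the same geodesics considered as unparametrised curves: every geodesic $\gamma\colon J\to M$ of $g$ on an open interval $J$ becomes a geodesic $\gamma\circ\varphi\colon J'\to M$ of $\bar g$ after a regular change of parameter $\varphi\colon J'\to J$ (a $C^2$ bijection of open intervals with nowhere vanishing derivative), and vice versa. Call a smooth vector field on $M$ a Killing vector field of a metric if its (local) flow preserves that metric, and non-trivial if it is not identically zero. If $g$ admits a non-trivial Killing vector field, then $\bar g$ also admits a non-trivial Killing vector field. -/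

import Mathlib

open Set
open scoped Manifold ContDiff

namespace GeodesicEquivalence

variable {n : ℕ} {M : Type*} [TopologicalSpace M] [ChartedSpace (EuclideanSpace ℝ (Fin n)) M]
  [IsManifold (𝓡 n) ∞ M]

variable (n M) in
/-- Smooth Riemannian metrics on the smooth `n`-manifold `M` (without boundary). -/
abbrev Metric : Type _ :=
  Bundle.ContMDiffRiemannianMetric (𝓡 n) ∞ (EuclideanSpace ℝ (Fin n))
    (fun x : M => TangentSpace (𝓡 n) x)

/-- The metric `g` in the coordinates of the chart around `p`: the pullback of `g` under the
inverse of that chart, as a bilinear form at the point `y` of the coordinate space. -/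
noncomputable def metricInChart (g : Metric n M) (p : M) (y v w : EuclideanSpace ℝ (Fin n)) : ℝ :=
  g.inner ((extChartAt (𝓡 n) p).symm y)
    (mfderiv 𝓘(ℝ, EuclideanSpace ℝ (Fin n)) (𝓡 n) (extChartAt (𝓡 n) p).symm y v)
    (mfderiv 𝓘(ℝ, EuclideanSpace ℝ (Fin n)) (𝓡 n) (extChartAt (𝓡 n) p).symm y w)

/-- `γ`, restricted to the open set `J` of times, is a (parametrised) geodesic of `g`: a `C²` curve
which satisfies, in every chart of the manifold, the Euler-Lagrange equation
`d/dt (∂L/∂ẋ) = ∂L/∂x` of the Lagrangian `L (x, ẋ) = (1/2) g_x (ẋ, ẋ)`. Here both sides are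
evaluated on an arbitrary coordinate vector `w`, so that the left side is
`d/dt (g_x (ẋ, w))` and the right side is the derivative of `x ↦ (1/2) g_x (ẋ, ẋ)` along `w`. -/
def IsGeodesicOn (g : Metric n M) (γ : ℝ → M) (J : Set ℝ) : Prop :=
  ContMDiffOn 𝓘(ℝ, ℝ) (𝓡 n) 2 γ J ∧
  ∀ p : M, ∀ t ∈ J, γ t ∈ (extChartAt (𝓡 n) p).source →
    ∀ w : EuclideanSpace ℝ (Fin n),
      let u : ℝ → EuclideanSpace ℝ (Fin n) := fun s => extChartAt (𝓡 n) p (γ s)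
      HasDerivAt (fun s => metricInChart g p (u s) (deriv u s) w)
        ((1 / 2 : ℝ) *
          fderiv ℝ (fun y => metricInChart g p y (deriv u t) (deriv u t)) (u t) w) t

/-- Every geodesic of `g`, defined on an arbitrary (bounded or unbounded) open interval `J`, is,
after a regular change of parameter `φ : J' → J`, a geodesic of `h`. -/
def GeodesicsReparametrize (g h : Metric n M) : Prop :=
  ∀ (γ : ℝ → M) (J : Set ℝ), IsOpen J → J.OrdConnected → IsGeodesicOn g γ J →
    ∃ (J' : Set ℝ) (φ : ℝ → ℝ), IsOpen J' ∧ J'.OrdConnected ∧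
      ContDiffOn ℝ 2 φ J' ∧ (∀ s ∈ J', deriv φ s ≠ 0) ∧ BijOn φ J' J ∧
      IsGeodesicOn h (γ ∘ φ) J'

/-- `g` and `h` are geodesically equivalent: they have the same geodesics, considered as
unparametrised curves. -/
def GeodesicallyEquivalent (g h : Metric n M) : Prop :=
  GeodesicsReparametrize g h ∧ GeodesicsReparametrize h g

/-- `θ` is a (`C¹`) local flow of the vector field `X`, defined for the times in `(a, b) ∋ 0` and
the initial points in the open set `U`: the curve `t ↦ θ t x` is the integral curve of `X` that
starts at `x`. -/
structure IsLocalFlow (X : (x : M) → TangentSpace (𝓡 n) x) (a b : ℝ) (U : Set M)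
    (θ : ℝ → M → M) : Prop where
  neg : a < 0
  pos : 0 < b
  isOpen : IsOpen U
  contMDiffOn : ContMDiffOn (𝓘(ℝ, ℝ).prod (𝓡 n)) (𝓡 n) 1
    (fun z : ℝ × M => θ z.1 z.2) (Ioo a b ×ˢ U)
  map_zero : ∀ x ∈ U, θ 0 x = x
  integralCurve : ∀ x ∈ U, IsMIntegralCurveOn (I := 𝓡 n) (fun t => θ t x) X (Ioo a b)

/-- `X` is a Killing vector field of `g`: a smooth vector field whose flow preserves `g`, that is,
`(θ t)^* g = g` for all local flows `θ` of `X` and all times `t`. (Local flows of a smooth vector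
field exist around every point, are unique, and are smooth.) -/
def IsKilling (g : Metric n M) (X : (x : M) → TangentSpace (𝓡 n) x) : Prop :=
  ContMDiff (𝓡 n) (𝓡 n).tangent ∞ (fun x => (⟨x, X x⟩ : TangentBundle (𝓡 n) M)) ∧
  ∀ (a b : ℝ) (U : Set M) (θ : ℝ → M → M), IsLocalFlow X a b U θ →
    ∀ t ∈ Ioo a b, ∀ x ∈ U, ∀ v w : TangentSpace (𝓡 n) x,
      g.inner (θ t x) (mfderiv (𝓡 n) (𝓡 n) (θ t) x v) (mfderiv (𝓡 n) (𝓡 n) (θ t) x w)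
        = g.inner x v w

end GeodesicEquivalence

/-! ### Traces and determinants of endomorphisms. -/

section LinearAlgebra

variable {E : Type*} [NormedAddCommGroup E] [NormedSpace ℝ E] [FiniteDimensional ℝ E]

/-! A Killing field is recognised by its conserved momentum: along a geodesic u of G with velocity
v, the derivative of G(X, v) is half of the Lie derivative (L_X G)(v, v), a purely algebraic
identity in the first derivatives of G and X.

Geodesic equivalence says that in coordinates the two sprays differ by a multiple σ(v) v of the
velocity (`spray_sub_spray`). The difference B of the Christoffel symbols of G and H then satisfies
B(v, v) = σ(v) v, and polarisation gives 2 tr B(v) = (n + 1) σ(v) (`trace_of_quadratic_parallel`).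
Since 2 tr Γ(v) is the trace of G⁻¹ dG(v), the logarithmic derivative of det G
(`two_mul_trace_christoffel`), the function `weight`, which is |det H / det G| to the power 1 / (n +
1), has logarithmic derivative -σ(v) (`hasDerivAt_weight`).

Define Y by H(Y, ·) = weight · G(X, ·) (`knebelman`). Along H-geodesics the extra acceleration σ(v)
v contributes σ(v) G(X, v) to the derivative of G(X, v), and the derivative of the weight cancels
exactly this term. Hence (L_Y H)(v, v) = weight · (L_X G)(v, v) = 0 (`lieQuad_eq_zero`). The field Y
vanishes only where X does (`knebelman_ne_zero`).

The rest links this computation to the definitions. Geodesics with prescribed initial velocity are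
needed to compare the sprays (`exists_isGeodesic`). Since Killing fields are defined by flows, one
needs the existence of `C¹` local flows (`exists_contDiffOn_localFlow`) and the formula for the
derivative of the pulled back metric (`IsFlow.hasDerivAt_fiberForm`). -/

theorem isInvertible_of_posDef {b : E →L[ℝ] E →L[ℝ] ℝ} (hb : ∀ v, v ≠ 0 → 0 < b v v) :
    b.IsInvertible := by
  have hinj : Function.Injective b := by
    rw [injective_iff_map_eq_zero]
    intro v hv
    by_contra h
    have := hb v h
    simp [hv] at this
  have hdim : Module.finrank ℝ E = Module.finrank ℝ (E →L[ℝ] ℝ) := by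
    rw [← (LinearMap.toContinuousLinearMap : (E →ₗ[ℝ] ℝ) ≃ₗ[ℝ] (E →L[ℝ] ℝ)).finrank_eq]
    exact (Subspace.dual_finrank_eq (K := ℝ) (V := E)).symm
  let e := LinearEquiv.ofInjectiveOfFinrankEq (b : E →ₗ[ℝ] (E →L[ℝ] ℝ)) hinj hdim
  refine ⟨e.toContinuousLinearEquiv, ?_⟩
  ext v w
  rfl

/-- An endomorphism which is skew with respect to a positive definite form has trace zero. -/
theorem trace_eq_zero_of_skew {b : E →L[ℝ] E →L[ℝ] ℝ} (hb : ∀ v, v ≠ 0 → 0 < b v v)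
    (P : E →ₗ[ℝ] E) (hP : ∀ v w, b (P v) w = - b v (P w)) :
    LinearMap.trace ℝ E P = 0 := by
  obtain ⟨e, he⟩ := isInvertible_of_posDef hb
  let d : E ≃ₗ[ℝ] Module.Dual ℝ E :=
    e.toLinearEquiv.trans (LinearMap.toContinuousLinearMap (𝕜 := ℝ) (E := E) (F' := ℝ)).symm
  have hd : ∀ v w, d v w = b v w := by
    intro v w
    rw [← he]
    rfl
  -- The form identifies E with its dual and turns P into minus its transpose, which has the
  -- opposite trace.
  have hconj : d.conj P = (-1 : ℝ) • Module.Dual.transpose (R := ℝ) P := by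
    ext l w
    obtain ⟨v, rfl⟩ := d.surjective l
    simp [LinearEquiv.conj_apply, hd, hP, Module.Dual.transpose_apply]
  have h1 : LinearMap.trace ℝ _ (d.conj P) = LinearMap.trace ℝ E P := LinearMap.trace_conj' P d
  rw [hconj, LinearMap.map_smul, LinearMap.trace_transpose', smul_eq_mul] at h1
  linarith

/-- No regularity or linearity of σ is needed: comparing the values at v + w and v - w shows that B
v is σ(v)/2 times the identity plus a map with image in the line of v. On v itself that remainder is
σ(v)/2, so the trace is (n + 1) σ(v)/2. -/
theorem trace_of_quadratic_parallel (B : E →ₗ[ℝ] E →ₗ[ℝ] E) (hB : ∀ v w, B v w = B w v)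
    (σ : E → ℝ) (hσ : ∀ v, B v v = σ v • v) {v : E} (hv : v ≠ 0) :
    2 * LinearMap.trace ℝ E (B v) = (Module.finrank ℝ E + 1) * σ v := by
  have key : ∀ w, ∃ α : ℝ, B v w = (σ v / 2) • w + α • v := by
    intro w
    by_cases hw : ∃ c : ℝ, c • v = w
    · obtain ⟨c, rfl⟩ := hw
      refine ⟨c * σ v / 2, ?_⟩
      rw [map_smul, hσ]
      module
    · have h1 := hσ (v + w)
      have h2 := hσ (v - w)
      simp only [map_add, map_sub, LinearMap.add_apply, LinearMap.sub_apply, hσ v, hσ w,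
        hB w v] at h1 h2
      set c := σ (v + w)
      set d := σ (v - w)
      have hli : (2 * σ v - (c + d)) • v + (2 * σ w - (c - d)) • w = 0 := by
        have : (2 * σ v - (c + d)) • v + (2 * σ w - (c - d)) • w =
          (σ v • v + B v w + (B v w + σ w • w) - c • (v + w)) +
            (σ v • v - B v w - (B v w - σ w • w) - d • (v - w)) := by module
        rw [this, h1, h2]
        simp
      have hw0 : 2 * σ w - (c - d) = 0 := by
        by_contra h0
        apply hw
        refine ⟨-((2 * σ w - (c - d))⁻¹ * (2 * σ v - (c + d))), ?_⟩
        have := congrArg (fun z => (2 * σ w - (c - d))⁻¹ • z) hli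
        simp only [smul_add, smul_smul, smul_zero, inv_mul_cancel₀ h0, one_smul] at this
        rw [neg_smul]
        exact neg_eq_of_add_eq_zero_right this
      have hv0 : 2 * σ v - (c + d) = 0 := by
        rw [hw0, zero_smul, add_zero] at hli
        exact (smul_eq_zero.1 hli).resolve_right hv
      refine ⟨(c - d) / 4, ?_⟩
      have h4 : (4 : ℝ) • B v w = c • (v + w) - d • (v - w) := by
        rw [← h1, ← h2]
        module
      have : B v w = (4 : ℝ)⁻¹ • ((4 : ℝ) • B v w) := by module
      rw [this, h4, show σ v = (c + d) / 2 by linarith]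
      module
  choose α hα using key
  -- A functional with value 1 at v exhibits the remainder as a rank one operator, whose trace can
  -- be read off.
  obtain ⟨l, hl⟩ : ∃ l : E →ₗ[ℝ] ℝ, l v = 1 := by
    obtain ⟨l, hl⟩ := SeparatingDual.exists_eq_one (R := ℝ) hv
    exact ⟨l, hl⟩
  set N : E →ₗ[ℝ] E := B v - (σ v / 2) • LinearMap.id with hN
  have hNw : ∀ w, N w = α w • v := by
    intro w
    simp [hN, hα w]
  have hNr : N = (l ∘ₗ N).smulRight v := by
    ext w
    simp [hNw, hl]
  have hBN : B v = (l ∘ₗ N).smulRight v + (σ v / 2) • LinearMap.id := by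
    rw [← hNr, hN]; abel
  rw [hBN, map_add, map_smul, LinearMap.trace_id, LinearMap.trace_smulRight]
  have : N v = (σ v / 2) • v := by
    simp only [hN, LinearMap.sub_apply, hσ, LinearMap.smul_apply, LinearMap.id_apply]
    module
  simp only [LinearMap.comp_apply, this, map_smul, hl, smul_eq_mul]
  ring

theorem contDiff_linearMap_det :
    ContDiff ℝ ∞ (fun B : E →L[ℝ] E => LinearMap.det (B : E →ₗ[ℝ] E)) := by
  classical
  let b := Module.finBasis ℝ E
  have h : (fun B : E →L[ℝ] E => LinearMap.det (B : E →ₗ[ℝ] E)) = fun B : E →L[ℝ] E =>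
      ∑ σ : Equiv.Perm (Fin (Module.finrank ℝ E)), ((Equiv.Perm.sign σ : ℤ) : ℝ) *
        ∏ i, b.coord (σ i) (B (b i)) := by
    ext B
    rw [← LinearMap.det_toMatrix b, Matrix.det_apply']
    simp [LinearMap.toMatrix_apply]
  rw [h]
  have h2 : ∀ i j, ContDiff ℝ ∞ (fun B : E →L[ℝ] E => b.coord i (B (b j))) := fun i j =>
    ((b.coord i).toContinuousLinearMap.comp
      (ContinuousLinearMap.apply ℝ E (b j))).contDiff
  refine ContDiff.sum fun σ _ => contDiff_const.mul (contDiff_prod fun i _ => h2 _ _)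

theorem hasDerivAt_det_one_add_smul (P : E →ₗ[ℝ] E) :
    HasDerivAt (fun s : ℝ => LinearMap.det (1 + s • P)) (LinearMap.trace ℝ E P) 0 := by
  classical
  let b := Module.finBasis ℝ E
  have h : (fun s : ℝ => LinearMap.det (1 + s • P)) =
      fun s => 1 + (LinearMap.toMatrix b b P).trace * s +
        (Polynomial.eval s (Matrix.det (1 + (Polynomial.X : Polynomial ℝ) •
          (LinearMap.toMatrix b b P).map Polynomial.C)).divX.divX) * s ^ 2 := by
    ext s
    rw [← Matrix.det_one_add_smul, ← LinearMap.det_toMatrix b]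
    simp [LinearMap.toMatrix_one]
  rw [h, LinearMap.trace_eq_matrix_trace ℝ b]
  set q := (Matrix.det (1 + (Polynomial.X : Polynomial ℝ) •
          (LinearMap.toMatrix b b P).map Polynomial.C)).divX.divX
  convert! (((hasDerivAt_id (0 : ℝ)).const_mul (LinearMap.toMatrix b b P).trace).const_add 1).add
    ((q.hasDerivAt 0).mul ((hasDerivAt_id (0 : ℝ)).pow 2)) using 1
  simp

/-- **Jacobi's formula** for the derivative of the determinant, at an invertible operator. -/
theorem HasDerivAt.linearMap_det {A : ℝ → E →L[ℝ] E} {A' C : E →L[ℝ] E} {t : ℝ}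
    (hA : HasDerivAt A A' t) (hC : A t ∘L C = ContinuousLinearMap.id ℝ E) :
    HasDerivAt (fun s => LinearMap.det (A s : E →ₗ[ℝ] E))
      (LinearMap.det (A t : E →ₗ[ℝ] E) * LinearMap.trace ℝ E ((C ∘L A' : E →L[ℝ] E) : E →ₗ[ℝ] E))
      t := by
  have hd := ((contDiff_linearMap_det (E := E)).differentiable (by simp) (A t)).hasFDerivAt
  have h1 := hd.comp_hasDerivAt t hA
  refine h1.congr_deriv ?_
  -- Differentiability is already known, so the derivative may be computed along the straight line A
  -- t + s A' = A t (1 + s C A').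
  have hline : HasDerivAt (fun s : ℝ => A t + s • A') A' 0 := by
    simpa using ((hasDerivAt_id (0 : ℝ)).smul_const A').const_add (A t)
  have h2 : HasDerivAt (fun s : ℝ => LinearMap.det ((A t + s • A' : E →L[ℝ] E) : E →ₗ[ℝ] E))
      (fderiv ℝ (fun B : E →L[ℝ] E => LinearMap.det (B : E →ₗ[ℝ] E)) (A t) A') 0 := by
    have hd' : HasFDerivAt (fun B : E →L[ℝ] E => LinearMap.det (B : E →ₗ[ℝ] E))
      (fderiv ℝ (fun B : E →L[ℝ] E => LinearMap.det (B : E →ₗ[ℝ] E)) (A t))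
      (A t + (0 : ℝ) • A') := by simpa using hd
    exact hd'.comp_hasDerivAt (0 : ℝ) hline
  have h3 : (fun s : ℝ => LinearMap.det ((A t + s • A' : E →L[ℝ] E) : E →ₗ[ℝ] E)) =
      fun s => LinearMap.det (A t : E →ₗ[ℝ] E) *
        LinearMap.det (1 + s • ((C ∘L A' : E →L[ℝ] E) : E →ₗ[ℝ] E)) := by
    ext s
    rw [← LinearMap.det_comp]
    congr 1
    ext v
    have := congrArg (fun T : E →L[ℝ] E => T (A' v)) hC
    simp only [ContinuousLinearMap.comp_apply, ContinuousLinearMap.id_apply] at this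
    simp [this]
  rw [h3] at h2
  exact h2.unique ((hasDerivAt_det_one_add_smul _).const_mul _)

end LinearAlgebra

/-! ### Knebelman's theorem in coordinates. -/

section ChartMetric
open Filter Topology ContinuousLinearMap

variable {E : Type*} [NormedAddCommGroup E] [NormedSpace ℝ E]

/-- The vector `S` such that the geodesics of the metric `G` are the solutions of
`u'' = spray G u u'`. -/
noncomputable def spray (G : E → E →L[ℝ] E →L[ℝ] ℝ) (y v : E) : E :=
  (G y).inverse ((1 / 2 : ℝ) • ((fderiv ℝ G y).flip v).flip v - fderiv ℝ G y v v)

/-- The expression of the Lie derivative of the metric `G` along the vector field `X`, as a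
quadratic form. -/
noncomputable def lieQuad (G : E → E →L[ℝ] E →L[ℝ] ℝ) (X : E → E) (y v : E) : ℝ :=
  fderiv ℝ G y (X y) v v + 2 * G y (fderiv ℝ X y v) v

/-- The operator which raises with `H` the index lowered with `G`. -/
noncomputable def ratio {V : Type*} [TopologicalSpace V] [AddCommGroup V] [Module ℝ V]
    (H G : V →L[ℝ] V →L[ℝ] ℝ) : V →L[ℝ] V :=
  H.inverse ∘L G

/-- The `1 / (n + 1)`-th power of the ratio of the volume densities squared. -/
noncomputable def weight {V : Type*} [TopologicalSpace V] [AddCommGroup V] [Module ℝ V]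
    (H G : V →L[ℝ] V →L[ℝ] ℝ) : ℝ :=
  (LinearMap.det (ratio H G : V →ₗ[ℝ] V) ^ 2) ^ (-(1 / (2 * (Module.finrank ℝ V + 1))) : ℝ)

variable {G H : E → E →L[ℝ] E →L[ℝ] ℝ} {y : E}

theorem fderiv_symm_of_eventually (hG : DifferentiableAt ℝ G y)
    (hs : ∀ᶠ z in 𝓝 y, ∀ v w, G z v w = G z w v) (u v w : E) :
    fderiv ℝ G y u v w = fderiv ℝ G y u w v := by
  have h1 : HasFDerivAt (fun z => G z v w) (((fderiv ℝ G y).flip v).flip w) y :=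
    (hG.hasFDerivAt.clm_apply (hasFDerivAt_const v y)).clm_apply (hasFDerivAt_const w y)
      |>.congr_fderiv (by ext; simp)
  have h2 : HasFDerivAt (fun z => G z w v) (((fderiv ℝ G y).flip w).flip v) y :=
    (hG.hasFDerivAt.clm_apply (hasFDerivAt_const w y)).clm_apply (hasFDerivAt_const v y)
      |>.congr_fderiv (by ext; simp)
  have h3 : (fun z => G z v w) =ᶠ[𝓝 y] fun z => G z w v := hs.mono fun z hz => hz v w
  have := (h2.congr_of_eventuallyEq h3).unique h1
  simpa using (DFunLike.congr_fun this u).symm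

/-- The Christoffel symbols of the metric `G` at the point `y`. -/
noncomputable def christoffel (G : E → E →L[ℝ] E →L[ℝ] ℝ) (y : E) : E →ₗ[ℝ] E →ₗ[ℝ] E :=
  LinearMap.mk₂ ℝ (fun v w => (G y).inverse ((1 / 2 : ℝ) •
      (fderiv ℝ G y v w + fderiv ℝ G y w v - ((fderiv ℝ G y).flip v).flip w)))
    (fun v v' w => by
      rw [← map_add]
      congr 1
      ext z
      simp
      ring)
    (fun c v w => by
      rw [← map_smul]
      congr 1
      ext z
      simp
      ring)
    (fun v w w' => by
      rw [← map_add]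
      congr 1
      ext z
      simp
      ring)
    (fun c v w => by
      rw [← map_smul]
      congr 1
      ext z
      simp
      ring)

theorem christoffel_apply (v w : E) : christoffel G y v w = (G y).inverse ((1 / 2 : ℝ) •
      (fderiv ℝ G y v w + fderiv ℝ G y w v - ((fderiv ℝ G y).flip v).flip w)) := rfl

theorem christoffel_self (v : E) : christoffel G y v v = - spray G y v := by
  rw [christoffel_apply, spray, ← map_neg]
  congr 1
  ext z
  simp
  ring

theorem christoffel_symm (hG : DifferentiableAt ℝ G y)
    (hs : ∀ᶠ z in 𝓝 y, ∀ v w, G z v w = G z w v) (v w : E) :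
    christoffel G y v w = christoffel G y w v := by
  rw [christoffel_apply, christoffel_apply]
  congr 1
  ext z
  simp [fderiv_symm_of_eventually hG hs z v w]
  ring

variable [FiniteDimensional ℝ E]

theorem apply_inverse_of_posDef {b : E →L[ℝ] E →L[ℝ] ℝ} (hb : ∀ v, v ≠ 0 → 0 < b v v)
    (c : E →L[ℝ] ℝ) : b (b.inverse c) = c := by
  obtain ⟨e, rfl⟩ := isInvertible_of_posDef hb
  simp

theorem inverse_apply_of_posDef {b : E →L[ℝ] E →L[ℝ] ℝ} (hb : ∀ v, v ≠ 0 → 0 < b v v)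
    (v : E) : b.inverse (b v) = v := by
  obtain ⟨e, rfl⟩ := isInvertible_of_posDef hb
  simp

theorem apply_spray (hp : ∀ v, v ≠ 0 → 0 < G y v v) (v w : E) :
    G y (spray G y v) w = 1 / 2 * fderiv ℝ G y w v v - fderiv ℝ G y v v w := by
  simp [spray, apply_inverse_of_posDef hp]

/-- Subtracting G⁻¹ dG(v) from 2 Γ(v) leaves, after lowering the index, dG(w)(v, z) - dG(z)(v, w).
This is skew in w and z, so the difference has trace zero. -/
theorem two_mul_trace_christoffel (hG : DifferentiableAt ℝ G y)
    (hs : ∀ᶠ z in 𝓝 y, ∀ v w, G z v w = G z w v) (hp : ∀ v, v ≠ 0 → 0 < G y v v) (v : E) :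
    2 * LinearMap.trace ℝ E (christoffel G y v) =
      LinearMap.trace ℝ E (((G y).inverse ∘L fderiv ℝ G y v : E →L[ℝ] E) : E →ₗ[ℝ] E) := by
  have h := trace_eq_zero_of_skew hp ((2 : ℝ) • christoffel G y v -
    (((G y).inverse ∘L fderiv ℝ G y v : E →L[ℝ] E) : E →ₗ[ℝ] E)) (fun w z => by
      have hsy : ∀ a b, G y a b = G y b a := hs.self_of_nhds
      rw [hsy w]
      simp only [LinearMap.sub_apply, LinearMap.smul_apply, christoffel_apply, map_sub, map_smul,
        coe_coe, comp_apply, sub_apply, smul_apply, apply_inverse_of_posDef hp, map_add, add_apply,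
        flip_apply, smul_eq_mul]
      rw [fderiv_symm_of_eventually hG hs v w z, fderiv_symm_of_eventually hG hs z v w,
        fderiv_symm_of_eventually hG hs w v z]
      ring)
  rw [LinearMap.map_sub, LinearMap.map_smul, smul_eq_mul] at h
  linarith

theorem ratio_inverse {b c : E →L[ℝ] E →L[ℝ] ℝ} (hb : ∀ v, v ≠ 0 → 0 < b v v)
    (hc : ∀ v, v ≠ 0 → 0 < c v v) : ratio b c ∘L ratio c b = ContinuousLinearMap.id ℝ E := by
  ext v
  simp [ratio, apply_inverse_of_posDef hc, inverse_apply_of_posDef hb]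

theorem det_ratio_ne_zero {b c : E →L[ℝ] E →L[ℝ] ℝ} (hb : ∀ v, v ≠ 0 → 0 < b v v)
    (hc : ∀ v, v ≠ 0 → 0 < c v v) : LinearMap.det (ratio b c : E →ₗ[ℝ] E) ≠ 0 := by
  intro h
  have h1 := congrArg (fun T : E →L[ℝ] E => LinearMap.det (T : E →ₗ[ℝ] E)) (ratio_inverse hb hc)
  have h2 : ((ratio b c ∘L ratio c b : E →L[ℝ] E) : E →ₗ[ℝ] E) =
    (ratio b c : E →ₗ[ℝ] E) ∘ₗ (ratio c b : E →ₗ[ℝ] E) := rfl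
  simp only [h2, LinearMap.det_comp, h, zero_mul] at h1
  simp at h1

theorem apply_ratio {b c : E →L[ℝ] E →L[ℝ] ℝ} (hb : ∀ v, v ≠ 0 → 0 < b v v) (v : E) :
    b (ratio b c v) = c v := by
  simp [ratio, apply_inverse_of_posDef hb]

variable {m : WithTop ℕ∞}

theorem ContDiffAt.ratio (hG : ContDiffAt ℝ m G y) (hH : ContDiffAt ℝ m H y)
    (hHp : ∀ v, v ≠ 0 → 0 < H y v v) : ContDiffAt ℝ m (fun z => ratio (H z) (G z)) y := by
  obtain ⟨e, he⟩ := isInvertible_of_posDef hHp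
  have h1 : ContDiffAt ℝ m (ContinuousLinearMap.inverse (R := ℝ) (M := E) (M₂ := E →L[ℝ] ℝ))
      (H y) := by
    rw [← he]
    exact contDiffAt_map_inverse e
  exact (h1.comp y hH).clm_comp hG

theorem ContDiffAt.weight (hG : ContDiffAt ℝ ∞ G y) (hH : ContDiffAt ℝ ∞ H y)
    (hGp : ∀ v, v ≠ 0 → 0 < G y v v)
    (hHp : ∀ v, v ≠ 0 → 0 < H y v v) : ContDiffAt ℝ ∞ (fun z => weight (H z) (G z)) y := by
  -- The base is the square of a nonzero determinant, so the real power is smooth and the sign of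
  -- the determinant plays no role.
  refine ContDiffAt.rpow_const_of_ne ?_ (pow_ne_zero 2 (det_ratio_ne_zero hHp hGp))
  exact (contDiff_linearMap_det.contDiffAt.comp y (hG.ratio hH hHp)).pow 2

theorem weight_pos {b c : E →L[ℝ] E →L[ℝ] ℝ} (hb : ∀ v, v ≠ 0 → 0 < b v v)
    (hc : ∀ v, v ≠ 0 → 0 < c v v) : 0 < weight b c :=
  Real.rpow_pos_of_pos (by have := det_ratio_ne_zero hb hc; positivity) _

/-- If the sprays of `G` and `H` differ, in the direction `v`, by `σ v`, then the logarithmic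
derivative of `weight H G` in this direction is `- σ`. -/
theorem hasDerivAt_weight (hG : ContDiffAt ℝ ∞ G y) (hH : ContDiffAt ℝ ∞ H y)
    (hGs : ∀ᶠ z in 𝓝 y, ∀ v w, G z v w = G z w v) (hGp : ∀ᶠ z in 𝓝 y, ∀ v, v ≠ 0 → 0 < G z v v)
    (hHs : ∀ᶠ z in 𝓝 y, ∀ v w, H z v w = H z w v) (hHp : ∀ᶠ z in 𝓝 y, ∀ v, v ≠ 0 → 0 < H z v v)
    (σ : E → ℝ) (hσ : ∀ v, spray H y v - spray G y v = σ v • v) {v : E} (hv : v ≠ 0) :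
    HasDerivAt (fun s : ℝ => weight (H (y + s • v)) (G (y + s • v)))
      (- σ v * weight (H y) (G y)) 0 := by
  have hGd := hG.differentiableAt (by simp)
  have hHd := hH.differentiableAt (by simp)
  have hline : HasDerivAt (fun s : ℝ => y + s • v) v 0 := by
    simpa using ((hasDerivAt_id (0 : ℝ)).smul_const v).const_add y
  set A := fun z => ratio (H z) (G z) with hA
  have hAd : DifferentiableAt ℝ A y :=
    (hG.ratio hH hHp.self_of_nhds).differentiableAt (by simp)
  set A' := fderiv ℝ A y v with hA'
  have hAl : HasDerivAt (fun s : ℝ => A (y + s • v)) A' 0 := by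
    have : HasFDerivAt A (fderiv ℝ A y) (y + (0 : ℝ) • v) := by simpa using hAd.hasFDerivAt
    exact this.comp_hasDerivAt (0 : ℝ) hline
  -- Product rule applied to H A = G. Composing with G⁻¹ expresses A⁻¹ A' through dG and dH, and
  -- cyclicity of the trace reduces it to tr G⁻¹ dG(v) - tr H⁻¹ dH(v).
  have hprod : H y ∘L A' + fderiv ℝ H y v ∘L A y = fderiv ℝ G y v := by
    have h1 := hHd.hasFDerivAt.clm_comp hAd.hasFDerivAt
    have h2 : (fun z => H z ∘L A z) =ᶠ[𝓝 y] G := hHp.mono fun z hz => by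
      ext1 w
      exact apply_ratio hz w
    have h3 := (hGd.hasFDerivAt.congr_of_eventuallyEq h2).unique h1
    rw [h3]
    simp [hA']
  have hdet := HasDerivAt.linearMap_det hAl (C := ratio (G y) (H y))
    (by simpa using ratio_inverse hHp.self_of_nhds hGp.self_of_nhds)
  have htr : LinearMap.trace ℝ E ((ratio (G y) (H y) ∘L A' : E →L[ℝ] E) : E →ₗ[ℝ] E) =
      (Module.finrank ℝ E + 1) * σ v := by
    have hBt := trace_of_quadratic_parallel (christoffel G y - christoffel H y)
      (fun a b => by
        simp only [LinearMap.sub_apply]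
        rw [christoffel_symm hGd hGs, christoffel_symm hHd hHs])
      σ (fun a => by
        rw [LinearMap.sub_apply, LinearMap.sub_apply, christoffel_self, christoffel_self, ← hσ a]
        abel) hv
    rw [← hBt, LinearMap.sub_apply, LinearMap.map_sub, mul_sub,
      two_mul_trace_christoffel hGd hGs hGp.self_of_nhds,
      two_mul_trace_christoffel hHd hHs hHp.self_of_nhds]
    have h1 : ((ratio (G y) (H y) ∘L A' : E →L[ℝ] E) : E →ₗ[ℝ] E) =
        (((G y).inverse ∘L fderiv ℝ G y v : E →L[ℝ] E) : E →ₗ[ℝ] E) -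
        ((G y).inverse ∘L fderiv ℝ H y v : E →L[ℝ] E) ∘ₗ (A y : E →ₗ[ℝ] E) := by
      rw [← hprod]
      ext w
      simp [ratio]
    have h2 : (A y : E →ₗ[ℝ] E) ∘ₗ ((G y).inverse ∘L fderiv ℝ H y v : E →L[ℝ] E) =
        (((H y).inverse ∘L fderiv ℝ H y v : E →L[ℝ] E) : E →ₗ[ℝ] E) := by
      ext w
      simp [hA, ratio, apply_inverse_of_posDef hGp.self_of_nhds]
    rw [h1, LinearMap.map_sub, LinearMap.trace_comp_comm', h2]
  rw [htr] at hdet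
  have hne := det_ratio_ne_zero hHp.self_of_nhds hGp.self_of_nhds
  have hne' : LinearMap.det (A (y + (0 : ℝ) • v) : E →ₗ[ℝ] E) ^ 2 ≠ 0 := by
    simpa [hA] using hne
  have hfin := (hdet.pow 2).rpow_const
    (p := (-(1 / (2 * (Module.finrank ℝ E + 1))) : ℝ)) (Or.inl hne')
  refine hfin.congr_deriv ?_
  simp only [zero_smul, add_zero, Pi.pow_apply] at hne' ⊢
  rw [weight, Real.rpow_sub_one hne']
  have hn : (Module.finrank ℝ E + 1 : ℝ) ≠ 0 := by positivity
  change LinearMap.det (A y : E →ₗ[ℝ] E) ≠ 0 at hne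
  simp only [hA] at hne ⊢
  field_simp
  push_cast
  ring

/-- **Knebelman's theorem** at a point: in the presence of a common system of unparametrised
geodesics, the infinitesimal isometries of `G` give infinitesimal isometries of `H`. -/
theorem lieQuad_eq_zero (hG : ContDiffAt ℝ ∞ G y) (hH : ContDiffAt ℝ ∞ H y)
    (hGs : ∀ᶠ z in 𝓝 y, ∀ v w, G z v w = G z w v) (hGp : ∀ᶠ z in 𝓝 y, ∀ v, v ≠ 0 → 0 < G z v v)
    (hHs : ∀ᶠ z in 𝓝 y, ∀ v w, H z v w = H z w v) (hHp : ∀ᶠ z in 𝓝 y, ∀ v, v ≠ 0 → 0 < H z v v)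
    (hproj : ∀ v, ∃ σ : ℝ, spray H y v - spray G y v = σ • v) {X : E → E}
    (hX : DifferentiableAt ℝ X y) (hLie : ∀ v, lieQuad G X y v = 0) (v : E) :
    lieQuad H (fun z => weight (H z) (G z) • ratio (H z) (G z) (X z)) y v = 0 := by
  rcases eq_or_ne v 0 with rfl | hv
  -- The value of σ at 0 is arbitrary, so the trace formula says nothing there.
  · simp [lieQuad]
  choose σ hσ using hproj
  have hGd := hG.differentiableAt (by simp)
  have hHd := hH.differentiableAt (by simp)
  set Y := fun z => weight (H z) (G z) • ratio (H z) (G z) (X z) with hY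
  have hYd : DifferentiableAt ℝ Y y :=
    ((hG.weight hH hGp.self_of_nhds hHp.self_of_nhds).differentiableAt (by simp)).smul
      (((hG.ratio hH hHp.self_of_nhds).differentiableAt (by simp)).clm_apply hX)
  have hline : HasDerivAt (fun s : ℝ => y + s • v) v 0 := by
    simpa using ((hasDerivAt_id (0 : ℝ)).smul_const v).const_add y
  -- The momentum is differentiated along a straight line with the velocity frozen at v; the
  -- acceleration terms enter algebraically through `h4` and `h5`, so no geodesic is needed here.
  have hlow : ∀ {K : E → E →L[ℝ] E →L[ℝ] ℝ} {Z : E → E}, DifferentiableAt ℝ K y →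
      DifferentiableAt ℝ Z y →
      HasDerivAt (fun s : ℝ => K (y + s • v) (Z (y + s • v)) v)
        (fderiv ℝ K y v (Z y) v + K y (fderiv ℝ Z y v) v) 0 := by
    intro K Z hK hZ
    have h0 := (hK.hasFDerivAt.clm_apply hZ.hasFDerivAt).clm_apply (hasFDerivAt_const v y)
    rw [← add_zero y, ← zero_smul ℝ v] at h0
    have h1 := h0.comp_hasDerivAt (0 : ℝ) hline
    exact HasDerivAt.congr_deriv h1 (by simp [add_comm])
  have h1 := hlow hHd hYd
  have h2 := (hasDerivAt_weight hG hH hGs hGp hHs hHp σ hσ hv).mul (hlow hGd hX)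
  have hev : (fun s : ℝ => H (y + s • v) (Y (y + s • v)) v) =ᶠ[𝓝 0]
      fun s => weight (H (y + s • v)) (G (y + s • v)) * G (y + s • v) (X (y + s • v)) v := by
    have : Tendsto (fun s : ℝ => y + s • v) (𝓝 0) (𝓝 y) := by
      simpa using hline.continuousAt.tendsto
    filter_upwards [this.eventually hHp] with s hs
    simp [hY, apply_ratio hs]
  have h3 := (h2.congr_of_eventuallyEq hev).unique h1
  simp only [zero_smul, add_zero] at h3
  have hHY : ∀ w, H y (Y y) w = weight (H y) (G y) * G y (X y) w := fun w => by
    simp [hY, apply_ratio hHp.self_of_nhds]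
  have h4 := apply_spray hHp.self_of_nhds v (Y y)
  have h5 := apply_spray hGp.self_of_nhds v (X y)
  -- The term σ v • v produces σ v times the weighted momentum, which cancels against the derivative
  -- of the weight in `h3`.
  rw [hHs.self_of_nhds, hHY, show spray H y v = spray G y v + σ v • v by rw [← hσ]; abel] at h4
  rw [hGs.self_of_nhds] at h5
  simp only [map_add, map_smul, smul_eq_mul] at h4
  rw [h5] at h4
  have h6 := hLie v
  have h7 := fderiv_symm_of_eventually hGd hGs v v (X y)
  have h8 := fderiv_symm_of_eventually hHd hHs v v (Y y)
  simp only [lieQuad] at h6 ⊢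
  linear_combination weight (H y) (G y) * h6 - 2 * h3 - 2 * h4
    - 2 * weight (H y) (G y) * h7 + 2 * h8

end ChartMetric

/-! ### Local flows of smooth vector fields are continuously differentiable. -/

section Flow
open Filter Topology ContinuousLinearMap

variable {E : Type*} [NormedAddCommGroup E] [NormedSpace ℝ E]

/-- Grönwall's inequality in both time directions; negative times follow by reversing time. -/
theorem norm_le_of_norm_deriv_le {f f' : ℝ → E} {K e ε : ℝ} (hK : 0 < K) (he : 0 ≤ e)
    (hf : ∀ t ∈ Ioo (-ε) ε, HasDerivAt f (f' t) t) (h0 : f 0 = 0)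
    (hb : ∀ t ∈ Ioo (-ε) ε, ‖f' t‖ ≤ K * ‖f t‖ + e) :
    ∀ t ∈ Ioo (-ε) ε, ‖f t‖ ≤ e / K * (Real.exp (K * ε) - 1) := by
  have main : ∀ {g g' : ℝ → E}, (∀ t ∈ Ioo (-ε) ε, HasDerivAt g (g' t) t) → g 0 = 0 →
      (∀ t ∈ Ioo (-ε) ε, ‖g' t‖ ≤ K * ‖g t‖ + e) → ∀ t ∈ Ico 0 ε,
      ‖g t‖ ≤ e / K * (Real.exp (K * ε) - 1) := by
    intro g g' hg hg0 hgb t ht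
    have hsub : ∀ s ∈ Icc 0 t, s ∈ Ioo (-ε) ε := fun s hs => by
      constructor <;> linarith [hs.1, hs.2, ht.1, ht.2]
    have := norm_le_gronwallBound_of_norm_deriv_right_le (f := g) (f' := g') (δ := 0) (K := K)
      (ε := e) (a := 0) (b := t)
      (fun s hs => (hg s (hsub s hs)).continuousAt.continuousWithinAt)
      (fun s hs => (hg s (hsub s (Ico_subset_Icc_self hs))).hasDerivWithinAt)
      (by simp [hg0]) (fun s hs => hgb s (hsub s (Ico_subset_Icc_self hs))) t ⟨ht.1, le_rfl⟩
    refine this.trans ?_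
    rw [gronwallBound_of_K_ne_0 hK.ne']
    simp only [zero_mul, sub_zero, zero_add]
    gcongr
    exact ht.2.le
  intro t ht
  rcases le_total 0 t with h | h
  · exact main hf h0 hb t ⟨h, ht.2⟩
  · have hneg : ∀ s ∈ Ioo (-ε) ε, -s ∈ Ioo (-ε) ε := fun s hs => by
      constructor <;> linarith [hs.1, hs.2]
    have := main (g := fun s => f (-s)) (g' := fun s => - f' (-s))
      (fun s hs => by
        simpa [Function.comp_def] using (hf (-s) (hneg s hs)).scomp s (hasDerivAt_neg s))
      (by simpa using h0)
      (fun s hs => by simpa using hb (-s) (hneg s hs)) (-t) ⟨by linarith, by linarith [ht.1]⟩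
    simpa using this

theorem contDiffOn_one_of_partial {f : ℝ × E → E} {D : Set (ℝ × E)} (hD : IsOpen D)
    {f₁ : ℝ × E → ℝ →L[ℝ] E} {f₂ : ℝ × E → E →L[ℝ] E} (h₁ : ContinuousOn f₁ D)
    (h₂ : ContinuousOn f₂ D) (hf : ∀ z ∈ D, HasFDerivAt f ((f₁ z).coprod (f₂ z)) z) :
    ContDiffOn ℝ 1 f D := by
  intro z hz
  refine ContDiffAt.contDiffWithinAt (contDiffAt_one_iff.2
    ⟨fun w => (f₁ w).coprod (f₂ w), D, hD.mem_nhds hz, ?_, hf⟩)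
  have : (fun w => (f₁ w).coprod (f₂ w)) = fun w =>
      f₁ w ∘L ContinuousLinearMap.fst ℝ ℝ E + f₂ w ∘L ContinuousLinearMap.snd ℝ ℝ E := by
    ext w <;> simp
  rw [this]
  exact (h₁.clm_comp continuousOn_const).add (h₂.clm_comp continuousOn_const)

variable [CompleteSpace E]

/-- The local flow of a smooth vector field depends continuously differentiably on the time and
the initial value. -/
theorem exists_contDiffOn_localFlow {X : E → E} {x₀ : E} (hX : ContDiffAt ℝ ∞ X x₀) {s : Set E}
    (hs : s ∈ 𝓝 x₀) :
    ∃ ε > (0 : ℝ), ∃ V : Set E, IsOpen V ∧ x₀ ∈ V ∧ ∃ θ : ℝ → E → E,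
      (∀ x ∈ V, θ 0 x = x) ∧
      (∀ x ∈ V, ∀ t ∈ Ioo (-ε) ε, θ t x ∈ s ∧ HasDerivAt (fun τ => θ τ x) (X (θ t x)) t) ∧
      ContDiffOn ℝ 1 (fun z : ℝ × E => θ z.1 z.2) (Ioo (-ε) ε ×ˢ V) := by
  have hX' : ContDiffAt ℝ 1 (fderiv ℝ X) x₀ := hX.fderiv_right (m := 1)
    (by rw [one_add_one_eq_two]; exact ENat.LEInfty.out)
  -- The field is coupled with its variational equation A' = dX(θ) A. Started at the identity, A is
  -- the candidate for the space derivative of the flow.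
  let Z : E × (E →L[ℝ] E) → E × (E →L[ℝ] E) := fun p => (X p.1, fderiv ℝ X p.1 ∘L p.2)
  have hZ : ContDiffAt ℝ 1 Z (x₀, ContinuousLinearMap.id ℝ E) := by
    have h1 : ContDiffAt ℝ 1 (fun p : E × (E →L[ℝ] E) => X p.1)
        (x₀, ContinuousLinearMap.id ℝ E) :=
      ContDiffAt.comp (g := X) (x₀, ContinuousLinearMap.id ℝ E) (hX.of_le (by simp)) contDiffAt_fst
    have h2 : ContDiffAt ℝ 1 (fun p : E × (E →L[ℝ] E) => fderiv ℝ X p.1)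
        (x₀, ContinuousLinearMap.id ℝ E) :=
      ContDiffAt.comp (g := fderiv ℝ X) (x₀, ContinuousLinearMap.id ℝ E) hX' contDiffAt_fst
    exact h1.prodMk (h2.clm_comp contDiffAt_snd)
  obtain ⟨ε₀, hε₀, a, r, L, K₀, hr, hpl⟩ := IsPicardLindelof.of_contDiffAt_one hZ
  obtain ⟨α, hα, L', hL'⟩ := (hpl 0).exists_forall_mem_closedBall_eq_hasDerivWithinAt_lipschitzOnWith
  have hcont : ContinuousOn (Function.uncurry α)
      (Metric.closedBall (x₀, ContinuousLinearMap.id ℝ E) r ×ˢ Icc (0 - ε₀) (0 + ε₀)) :=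
    continuousOn_prod_of_continuousOn_lipschitzOnWith _ L'
      (fun x hx => HasDerivWithinAt.continuousOn (hα x hx).2) hL'
  simp only [zero_sub, zero_add] at hα hL' hcont
  -- the flow and the solution of the linearised equation
  set θ : ℝ → E → E := fun t x => (α (x, ContinuousLinearMap.id ℝ E) t).1 with hθ
  set A : ℝ → E → E →L[ℝ] E := fun t x => (α (x, ContinuousLinearMap.id ℝ E) t).2 with hA
  obtain ⟨C, s₁, hs₁, hlip⟩ := hX'.exists_lipschitzOnWith
  have hdiff : ∀ᶠ z in 𝓝 x₀, DifferentiableAt ℝ X z :=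
    ((hX.of_le (m := 1) (by simp)).eventually (by simp)).mono fun z hz =>
      hz.differentiableAt (by simp)
  have hbd : ∀ᶠ z in 𝓝 x₀, ‖fderiv ℝ X z‖ < ‖fderiv ℝ X x₀‖ + 1 :=
    hX'.continuousAt.norm.eventually (gt_mem_nhds (by linarith))
  have hXc : ∀ᶠ z in 𝓝 x₀, ContinuousAt X z ∧ ContinuousAt (fderiv ℝ X) z :=
    (((hX.of_le (m := 1) (by simp)).eventually (by simp)).and (hX'.eventually (by simp))).mono
      fun z hz => ⟨hz.1.continuousAt, hz.2.continuousAt⟩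
  obtain ⟨δ, hδ, hball⟩ := Metric.mem_nhds_iff.1
    (inter_mem hs (inter_mem hs₁ (inter_mem (inter_mem hdiff hbd) hXc)))
  -- The summand 1 makes the bound valid near x₀ and keeps K nonzero for the Grönwall estimate.
  set K := ‖fderiv ℝ X x₀‖ + 1 with hK
  have hKpos : 0 < K := by positivity
  have hin : ∀ x ∈ Metric.closedBall x₀ r,
      (x, ContinuousLinearMap.id ℝ E) ∈
        Metric.closedBall (x₀, ContinuousLinearMap.id ℝ E) (r : ℝ) := by
    intro x hx
    simpa [Prod.dist_eq] using hx
  have hcont2 : ContinuousOn (fun z : ℝ × E => α (z.2, ContinuousLinearMap.id ℝ E) z.1)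
      (Icc (-ε₀) ε₀ ×ˢ Metric.closedBall x₀ r) := by
    refine hcont.comp (f := fun z : ℝ × E => ((z.2, ContinuousLinearMap.id ℝ E), z.1))
      (by fun_prop) ?_
    rintro ⟨t, x⟩ ⟨ht, hx⟩
    exact ⟨hin x hx, ht⟩
  have hr' : (0 : ℝ) < r := by exact_mod_cast hr
  have hnhds : Icc (-ε₀) ε₀ ×ˢ Metric.closedBall x₀ (r : ℝ) ∈ 𝓝 ((0 : ℝ), x₀) :=
    prod_mem_nhds (Icc_mem_nhds (by linarith) hε₀) (Metric.closedBall_mem_nhds _ hr')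
  have hθ0 : ∀ x ∈ Metric.closedBall x₀ (r : ℝ), θ 0 x = x := fun x hx => by
    simp [hθ, (hα _ (hin x hx)).1]
  have hmem : ∀ᶠ z : ℝ × E in 𝓝 ((0 : ℝ), x₀), θ z.1 z.2 ∈ Metric.ball x₀ δ := by
    have hc : ContinuousAt (fun z : ℝ × E => θ z.1 z.2) ((0 : ℝ), x₀) :=
      (hcont2.continuousAt hnhds).fst
    apply hc
    simp only [hθ0 x₀ (Metric.mem_closedBall_self hr'.le)]
    exact Metric.ball_mem_nhds _ hδ
  obtain ⟨ε, hε, hεr⟩ := Metric.mem_nhds_iff.1 (inter_mem hmem hnhds)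
  have hsub : ∀ t ∈ Ioo (-ε) ε, ∀ x ∈ Metric.ball x₀ ε,
      θ t x ∈ Metric.ball x₀ δ ∧ t ∈ Icc (-ε₀) ε₀ ∧ x ∈ Metric.closedBall x₀ (r : ℝ) := by
    intro t ht x hx
    have : (t, x) ∈ Metric.ball ((0 : ℝ), x₀) ε := by
      rw [Metric.mem_ball, Prod.dist_eq, max_lt_iff]
      exact ⟨by simpa [abs_lt] using ht, hx⟩
    exact ⟨(hεr this).1, (hεr this).2.1, (hεr this).2.2⟩
  have hmem0 : (0 : ℝ) ∈ Ioo (-ε) ε := ⟨by linarith, hε⟩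
  have hnb : ∀ t ∈ Ioo (-ε) ε, Icc (-ε₀) ε₀ ∈ 𝓝 t := fun t ht =>
    mem_of_superset (isOpen_Ioo.mem_nhds ht) fun t' ht' =>
      (hsub t' ht' x₀ (Metric.mem_ball_self hε)).2.1
  have hderiv : ∀ t ∈ Ioo (-ε) ε, ∀ x ∈ Metric.ball x₀ ε,
      HasDerivAt (fun τ => θ τ x) (X (θ t x)) t ∧
        HasDerivAt (fun τ => A τ x) (fderiv ℝ X (θ t x) ∘L A t x) t := by
    intro t ht x hx
    obtain ⟨-, h2, h3⟩ := hsub t ht x hx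
    have h4 := ((hα _ (hin x h3)).2 t h2).hasDerivAt (hnb t ht)
    exact ⟨h4.hasFDerivAt.fst.hasDerivAt.congr_deriv (by simp [Z, hθ]),
      h4.hasFDerivAt.snd.hasDerivAt.congr_deriv (by simp [Z, hθ, hA])⟩
  have hθlip : ∀ t ∈ Ioo (-ε) ε, ∀ x ∈ Metric.ball x₀ ε, ∀ x' ∈ Metric.ball x₀ ε,
      ‖θ t x' - θ t x‖ ≤ L' * ‖x' - x‖ := by
    intro t ht x hx x' hx'
    have h1 := (hL' t (hsub t ht x hx).2.1).norm_sub_le (hin x' (hsub t ht x' hx').2.2)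
      (hin x (hsub t ht x hx).2.2)
    have h2 : ‖(x', ContinuousLinearMap.id ℝ E) - (x, ContinuousLinearMap.id ℝ E)‖ = ‖x' - x‖ := by
      simp [Prod.norm_def]
    rw [h2] at h1
    exact (_root_.norm_fst_le _).trans h1
  have htaylor : ∀ a ∈ Metric.ball x₀ δ, ∀ b ∈ Metric.ball x₀ δ,
      ‖X b - X a - fderiv ℝ X a (b - a)‖ ≤ C * ‖b - a‖ * ‖b - a‖ := by
    intro a ha b hb
    have hseg : segment ℝ a b ⊆ Metric.ball x₀ δ := (convex_ball x₀ δ).segment_subset ha hb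
    refine Convex.norm_image_sub_le_of_norm_hasFDerivWithin_le' (s := segment ℝ a b)
      (f' := fderiv ℝ X) (fun z hz =>
        (hball (hseg hz)).2.2.1.1.hasFDerivAt.hasFDerivWithinAt) (fun z hz => ?_)
      (convex_segment a b) (left_mem_segment ℝ a b) (right_mem_segment ℝ a b)
    refine (hlip.norm_sub_le (hball (hseg hz)).2.1 (hball ha).2.1).trans ?_
    gcongr
    exact norm_sub_le_of_mem_segment hz
  have hspace : ∀ t ∈ Ioo (-ε) ε, ∀ x ∈ Metric.ball x₀ ε, HasFDerivAt (θ t) (A t x) x := by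
    intro t ht x hx
    rw [hasFDerivAt_iff_isLittleO_nhds_zero]
    -- The error of the linear approximation by A vanishes at time 0, and its derivative is dX(θ)
    -- applied to the error plus a Taylor remainder. That remainder is quadratic in k, because the
    -- flow is Lipschitz in the initial value. Grönwall then bounds the error by a multiple of ‖k‖².
    have hbig : (fun k : E => θ t (x + k) - θ t x - A t x k) =O[𝓝 0] fun k => ‖k‖ ^ 2 := by
      refine Asymptotics.IsBigO.of_bound (C * L' * L' / K * (Real.exp (K * ε) - 1)) ?_
      have hev : ∀ᶠ k : E in 𝓝 0, x + k ∈ Metric.ball x₀ ε := by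
        have : Tendsto (fun k : E => x + k) (𝓝 0) (𝓝 x) := by
          simpa using (continuous_const.add continuous_id).tendsto (0 : E) (f := fun k : E => x + k)
        exact this.eventually (Metric.isOpen_ball.mem_nhds hx)
      filter_upwards [hev] with k hk
      have := norm_le_of_norm_deriv_le (f := fun τ => θ τ (x + k) - θ τ x - A τ x k)
        (f' := fun τ => X (θ τ (x + k)) - X (θ τ x) - (fderiv ℝ X (θ τ x) ∘L A τ x) k)
        (K := K) (e := C * L' * L' * ‖k‖ ^ 2) (ε := ε) hKpos (by positivity)
        (fun τ hτ => ((hderiv τ hτ _ hk).1.sub (hderiv τ hτ x hx).1).sub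
          (((hderiv τ hτ x hx).2.clm_apply (hasDerivAt_const τ k)).congr_deriv (by simp)))
        (by
          have h1 : A 0 x = ContinuousLinearMap.id ℝ E := by
            simp [hA, (hα _ (hin x (hsub 0 hmem0 x hx).2.2)).1]
          simp [hθ0 x (hsub 0 hmem0 x hx).2.2, hθ0 _ (hsub 0 hmem0 _ hk).2.2, h1])
        (fun τ hτ => by
          have h1 := htaylor _ (hsub τ hτ x hx).1 _ (hsub τ hτ _ hk).1
          have h2 := hθlip τ hτ x hx _ hk
          rw [add_sub_cancel_left] at h2
          have h3 : ‖fderiv ℝ X (θ τ x)‖ ≤ K := (hball (hsub τ hτ x hx).1).2.2.1.2.le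
          have h4 : X (θ τ (x + k)) - X (θ τ x) - (fderiv ℝ X (θ τ x) ∘L A τ x) k =
            fderiv ℝ X (θ τ x) (θ τ (x + k) - θ τ x - A τ x k) +
            (X (θ τ (x + k)) - X (θ τ x) - fderiv ℝ X (θ τ x) (θ τ (x + k) - θ τ x)) := by
            simp only [map_sub, comp_apply]
            abel
          rw [h4]
          refine (norm_add_le _ _).trans (add_le_add ?_ ?_)
          · exact ((fderiv ℝ X (θ τ x)).le_opNorm _).trans (by gcongr)
          · calc _ ≤ C * ‖θ τ (x + k) - θ τ x‖ * ‖θ τ (x + k) - θ τ x‖ := h1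
              _ ≤ C * (L' * ‖k‖) * (L' * ‖k‖) := by gcongr
              _ = C * L' * L' * ‖k‖ ^ 2 := by ring) t ht
      refine this.trans (le_of_eq ?_)
      rw [norm_pow, norm_norm]
      ring
    exact hbig.trans_isLittleO (Asymptotics.isLittleO_norm_pow_id one_lt_two)
  have hopen : IsOpen (Ioo (-ε) ε ×ˢ Metric.ball x₀ ε) := isOpen_Ioo.prod Metric.isOpen_ball
  have hcα : ContinuousOn (fun z : ℝ × E => α (z.2, ContinuousLinearMap.id ℝ E) z.1)
      (Ioo (-ε) ε ×ˢ Metric.ball x₀ ε) :=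
    hcont2.mono fun z hz => ⟨(hsub _ hz.1 _ hz.2).2.1, (hsub _ hz.1 _ hz.2).2.2⟩
  have hcθ : ContinuousOn (fun z : ℝ × E => toSpanSingleton ℝ (X (θ z.1 z.2)))
      (Ioo (-ε) ε ×ˢ Metric.ball x₀ ε) := by
    intro z hz
    have h1 : ContinuousWithinAt (fun z : ℝ × E => X (θ z.1 z.2))
        (Ioo (-ε) ε ×ˢ Metric.ball x₀ ε) z :=
      ContinuousAt.comp_continuousWithinAt (g := X) (f := fun z : ℝ × E => θ z.1 z.2)
        (hball (hsub _ hz.1 _ hz.2).1).2.2.2.1 (hcα z hz).fst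
    exact ((toSpanSingletonCLE (𝕜 := ℝ) (E := E)).continuous.continuousAt).comp_continuousWithinAt h1
  have hcA : ContinuousOn (fun z : ℝ × E => A z.1 z.2) (Ioo (-ε) ε ×ˢ Metric.ball x₀ ε) :=
    fun z hz => (hcα z hz).snd
  have hstrict : ∀ z ∈ Ioo (-ε) ε ×ˢ Metric.ball x₀ ε,
      HasStrictFDerivAt (fun z : ℝ × E => θ z.1 z.2)
        ((toSpanSingleton ℝ (X (θ z.1 z.2))).coprod (A z.1 z.2)) z := by
    intro z hz
    exact hasStrictFDerivAt_uncurry_coprod (f := θ)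
      (f₁ := fun t x => toSpanSingleton ℝ (X (θ t x))) (f₂ := A)
      (mem_of_superset (hopen.mem_nhds hz) fun w hw => (hderiv _ hw.1 _ hw.2).1.hasFDerivAt)
      (mem_of_superset (hopen.mem_nhds hz) fun w hw => hspace _ hw.1 _ hw.2)
      (hcθ.continuousAt (hopen.mem_nhds hz)) (hcA.continuousAt (hopen.mem_nhds hz))
  refine ⟨ε, hε, Metric.ball x₀ ε, Metric.isOpen_ball, Metric.mem_ball_self hε, θ,
    fun x hx => hθ0 x (hsub 0 hmem0 x hx).2.2,
    fun x hx t ht => ⟨(hball (hsub t ht x hx).1).1, (hderiv t ht x hx).1⟩, contDiffOn_one_of_partial hopen hcθ hcA fun z hz => (hstrict z hz).hasFDerivAt⟩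

end Flow

/-! ### Second order equations and interchange of partial derivatives. -/

section SecondOrder
open Filter Topology ContinuousLinearMap

variable {E : Type*} [NormedAddCommGroup E] [NormedSpace ℝ E]

theorem contDiffOn_two_of_hasDerivAt {u u' u'' : ℝ → E} {J : Set ℝ} (hJ : IsOpen J)
    (h1 : ∀ t ∈ J, HasDerivAt u (u' t) t) (h2 : ∀ t ∈ J, HasDerivAt u' (u'' t) t)
    (hc : ContinuousOn u'' J) : ContDiffOn ℝ 2 u J := by
  have h3 : ContDiffOn ℝ 1 u' J := by
    rw [← zero_add (1 : WithTop ℕ∞), contDiffOn_succ_iff_deriv_of_isOpen hJ]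
    refine ⟨fun t ht => (h2 t ht).differentiableAt.differentiableWithinAt, by simp, ?_⟩
    rw [contDiffOn_zero]
    exact hc.congr fun t ht => (h2 t ht).deriv
  rw [← one_add_one_eq_two, contDiffOn_succ_iff_deriv_of_isOpen hJ]
  exact ⟨fun t ht => (h1 t ht).differentiableAt.differentiableWithinAt, by simp,
    h3.congr fun t ht => (h1 t ht).deriv⟩

/-- Solved as a first order system for (u, u'). The time interval is shrunk so that u stays in s and
S stays continuous along the solution, which is what makes u of class C². -/
theorem exists_solution_secondOrder [CompleteSpace E] {S : E → E → E} {y v : E}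
    (hS : ContDiffAt ℝ 1 (fun z : E × E => S z.1 z.2) (y, v)) {s : Set E} (hs : s ∈ 𝓝 y) :
    ∃ ε > (0 : ℝ), ∃ u u' : ℝ → E, u 0 = y ∧ u' 0 = v ∧ ContDiffOn ℝ 2 u (Ioo (-ε) ε) ∧
      ∀ t ∈ Ioo (-ε) ε, u t ∈ s ∧ HasDerivAt u (u' t) t ∧
        HasDerivAt u' (S (u t) (u' t)) t := by
  obtain ⟨α, hα0, ε, hε, hα⟩ :=
    (contDiffAt_snd.prodMk hS).exists_forall_mem_closedBall_exists_eq_forall_mem_Ioo_hasDerivAt₀ 0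
  simp only [zero_sub, zero_add] at hα
  have hαc : ContinuousAt α 0 := (hα 0 ⟨by linarith, hε⟩).continuousAt
  have hev : ∀ᶠ z : E × E in 𝓝 (y, v), z.1 ∈ s ∧ ContinuousAt (fun z : E × E => S z.1 z.2) z :=
    (continuousAt_fst.eventually (by exact hs)).and
      ((hS.eventually (by simp)).mono fun z hz => hz.continuousAt)
  rw [← hα0] at hev
  obtain ⟨δ, hδ, hδs⟩ := Metric.eventually_nhds_iff.1 (hαc.eventually hev)
  have hmin : ∀ t ∈ Ioo (-(min ε δ)) (min ε δ), t ∈ Ioo (-ε) ε ∧ dist t 0 < δ := by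
    intro t ht
    have h1 : |t| < min ε δ := abs_lt.2 ht
    refine ⟨abs_lt.1 (h1.trans_le (min_le_left _ _)), ?_⟩
    simpa using h1.trans_le (min_le_right _ _)
  have hd : ∀ t ∈ Ioo (-(min ε δ)) (min ε δ), HasDerivAt (fun t => (α t).1) (α t).2 t ∧
      HasDerivAt (fun t => (α t).2) (S (α t).1 (α t).2) t := fun t ht =>
    ⟨(hα t (hmin t ht).1).hasFDerivAt.fst.hasDerivAt.congr_deriv (by simp),
      (hα t (hmin t ht).1).hasFDerivAt.snd.hasDerivAt.congr_deriv (by simp)⟩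
  refine ⟨min ε δ, lt_min hε hδ, fun t => (α t).1, fun t => (α t).2, by simp [hα0],
    by simp [hα0], contDiffOn_two_of_hasDerivAt isOpen_Ioo (fun t ht => (hd t ht).1)
      (fun t ht => (hd t ht).2) fun t ht => ?_, fun t ht => ⟨(hδs (hmin t ht).2).1, hd t ht⟩⟩
  exact (ContinuousAt.comp (g := fun z : E × E => S z.1 z.2) (hδs (hmin t ht).2).2
    (hα t (hmin t ht).1).continuousAt).continuousWithinAt

/-- Interchange of the partial derivatives of a function of two real variables: it is enough that
the derivative `Z` with respect to the first one is strictly differentiable. -/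
theorem hasDerivAt_partial_comm {σ Z : ℝ → ℝ → E} {D : ℝ → E} {t₀ r₀ : ℝ}
    {Z' : ℝ × ℝ →L[ℝ] E}
    (hσ : ∀ᶠ z : ℝ × ℝ in 𝓝 (t₀, r₀), HasDerivAt (fun t => σ t z.2) (Z z.1 z.2) z.1)
    (hD : ∀ᶠ t in 𝓝 t₀, HasDerivAt (σ t) (D t) r₀)
    (hZ : HasStrictFDerivAt (fun z : ℝ × ℝ => Z z.1 z.2) Z' (t₀, r₀)) :
    HasDerivAt D (Z' (0, 1)) t₀ := by
  rw [hasDerivAt_iff_isLittleO, Asymptotics.isLittleO_iff]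
  intro c hc
  have h1 : ∀ᶠ z : ℝ × ℝ in 𝓝 (t₀, r₀),
      ‖Z z.1 z.2 - Z z.1 r₀ - (z.2 - r₀) • Z' (0, 1)‖ ≤ c * ‖z.2 - r₀‖ := by
    have h2 : Tendsto (fun z : ℝ × ℝ => (z, (z.1, r₀))) (𝓝 (t₀, r₀))
        (𝓝 ((t₀, r₀), (t₀, r₀))) := by
      have : Continuous fun z : ℝ × ℝ => (z, (z.1, r₀)) := by fun_prop
      exact this.tendsto (t₀, r₀)
    filter_upwards [h2.eventually (Asymptotics.isLittleO_iff.1 hZ.isLittleO hc)] with z hz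
    have h3 : z - (z.1, r₀) = (z.2 - r₀) • ((0 : ℝ), (1 : ℝ)) := by
      ext <;> simp
    simp only [h3, map_smul, norm_smul] at hz
    simpa using hz
  obtain ⟨ρ, hρ, hball⟩ := Metric.eventually_nhds_iff.1 (hσ.and h1)
  have hDball : ∀ᶠ t in 𝓝 t₀, HasDerivAt (σ t) (D t) r₀ ∧ dist t t₀ < ρ :=
    hD.and (Metric.ball_mem_nhds _ hρ)
  filter_upwards [hDball] with t ht
  -- The bound is proved for difference quotients in r and passes to the limit.
  have hlim : Tendsto (fun r => ‖(r - r₀)⁻¹ • (σ t r - σ t r₀) -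
      (r - r₀)⁻¹ • (σ t₀ r - σ t₀ r₀) - (t - t₀) • Z' (0, 1)‖) (𝓝[≠] r₀)
      (𝓝 ‖D t - D t₀ - (t - t₀) • Z' (0, 1)‖) := by
    have a1 := hasDerivAt_iff_tendsto_slope.1 ht.1
    have a2 := hasDerivAt_iff_tendsto_slope.1 hD.self_of_nhds
    exact ((a1.sub a2).sub tendsto_const_nhds).norm
  refine le_of_tendsto hlim ?_
  filter_upwards [self_mem_nhdsWithin, mem_nhdsWithin_of_mem_nhds (Metric.ball_mem_nhds r₀ hρ)]
    with r hr hrρ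
  have hr0 : r - r₀ ≠ 0 := sub_ne_zero.2 hr
  have hin : ∀ τ ∈ uIcc t₀ t, dist τ t₀ < ρ := by
    intro τ hτ
    have h4 : |τ - t₀| ≤ |t - t₀| := abs_sub_left_of_mem_uIcc hτ
    exact h4.trans_lt ht.2
  -- Mean value inequality in the first variable, applied to the increment in the second one. Only
  -- first derivatives in t occur, so no second derivative of σ need be known in advance.
  have hmvt := Convex.norm_image_sub_le_of_norm_hasDerivWithin_le (s := uIcc t₀ t)
    (f := fun τ => σ τ r - σ τ r₀ - (τ - t₀) • (r - r₀) • Z' (0, 1))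
    (f' := fun τ => Z τ r - Z τ r₀ - (r - r₀) • Z' (0, 1)) (C := c * ‖r - r₀‖)
    (fun τ hτ => by
      have b1 := (hball (y := (τ, r)) (by
        rw [Prod.dist_eq, max_lt_iff]; exact ⟨hin τ hτ, hrρ⟩)).1
      have b2 := (hball (y := (τ, r₀)) (by
        rw [Prod.dist_eq, max_lt_iff]; exact ⟨hin τ hτ, by simpa using hρ⟩)).1
      have b3 : HasDerivAt (fun τ : ℝ => (τ - t₀) • (r - r₀) • Z' (0, 1))
          ((r - r₀) • Z' (0, 1)) τ := by
        simpa using ((hasDerivAt_id τ).sub_const t₀).smul_const ((r - r₀) • Z' (0, 1))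
      exact ((b1.sub b2).sub b3).hasDerivWithinAt)
    (fun τ hτ => (hball (y := (τ, r)) (by
        rw [Prod.dist_eq, max_lt_iff]; exact ⟨hin τ hτ, hrρ⟩)).2)
    (convex_uIcc t₀ t) left_mem_uIcc right_mem_uIcc
  have hfac : (r - r₀)⁻¹ • (σ t r - σ t r₀) - (r - r₀)⁻¹ • (σ t₀ r - σ t₀ r₀) -
      (t - t₀) • Z' (0, 1) = (r - r₀)⁻¹ • ((σ t r - σ t r₀ - (t - t₀) • (r - r₀) • Z' (0, 1)) -
        (σ t₀ r - σ t₀ r₀ - (t₀ - t₀) • (r - r₀) • Z' (0, 1))) := by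
    rw [sub_self, zero_smul, sub_zero]
    simp only [smul_sub]
    rw [smul_comm (t - t₀), smul_smul (r - r₀)⁻¹, inv_mul_cancel₀ hr0, one_smul]
    abel
  rw [hfac, norm_smul, norm_inv]
  rw [inv_mul_le_iff₀ (norm_pos_iff.2 hr0)]
  exact hmvt.trans (le_of_eq (by ring))

end SecondOrder

/-! ### Metrics and changes of coordinates in charts. -/

namespace GeodesicEquivalence

section Charts
open Filter Topology ContinuousLinearMap

variable {E : Type*} [NormedAddCommGroup E] [NormedSpace ℝ E]
  {M : Type*} [TopologicalSpace M] [ChartedSpace E M]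

variable (E M) in
/-- Smooth Riemannian metrics on a smooth manifold modelled on `E`. -/
abbrev RiemannianMetric [IsManifold 𝓘(ℝ, E) ∞ M] : Type _ :=
  Bundle.ContMDiffRiemannianMetric 𝓘(ℝ, E) ∞ E (fun x : M => TangentSpace 𝓘(ℝ, E) x)

/-- The derivative at `y` of the inverse of the chart around `p`. -/
noncomputable def chartDeriv (p : M) (y : E) : E →L[ℝ] E :=
  mfderiv 𝓘(ℝ, E) 𝓘(ℝ, E) (extChartAt 𝓘(ℝ, E) p).symm y

theorem isOpen_target (p : M) : IsOpen (extChartAt 𝓘(ℝ, E) p).target :=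
  isOpen_extChartAt_target p

theorem target_mem_nhds {p : M} {y : E} (hy : y ∈ (extChartAt 𝓘(ℝ, E) p).target) :
    (extChartAt 𝓘(ℝ, E) p).target ∈ 𝓝 y :=
  (isOpen_target p).mem_nhds hy

variable [IsManifold 𝓘(ℝ, E) ∞ M]

theorem contMDiffAt_symm {p : M} {y : E} (hy : y ∈ (extChartAt 𝓘(ℝ, E) p).target) :
    ContMDiffAt 𝓘(ℝ, E) 𝓘(ℝ, E) ∞ (extChartAt 𝓘(ℝ, E) p).symm y :=
  (contMDiffOn_extChartAt_symm p).contMDiffAt (target_mem_nhds hy)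

theorem contMDiffAt_chart {p x : M} (hx : x ∈ (extChartAt 𝓘(ℝ, E) p).source) :
    ContMDiffAt 𝓘(ℝ, E) 𝓘(ℝ, E) ∞ (extChartAt 𝓘(ℝ, E) p) x :=
  contMDiffAt_extChartAt' (by simpa using hx)

theorem mdifferentiableAt_symm {p : M} {y : E} (hy : y ∈ (extChartAt 𝓘(ℝ, E) p).target) :
    MDifferentiableAt 𝓘(ℝ, E) 𝓘(ℝ, E) (extChartAt 𝓘(ℝ, E) p).symm y :=
  (contMDiffAt_symm hy).mdifferentiableAt (by simp)

theorem mdifferentiableAt_chart {p x : M} (hx : x ∈ (extChartAt 𝓘(ℝ, E) p).source) :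
    MDifferentiableAt 𝓘(ℝ, E) 𝓘(ℝ, E) (extChartAt 𝓘(ℝ, E) p) x :=
  (contMDiffAt_chart hx).mdifferentiableAt (by simp)

theorem isInvertible_chartDeriv {p : M} {y : E} (hy : y ∈ (extChartAt 𝓘(ℝ, E) p).target) :
    (chartDeriv p y).IsInvertible := by
  have := isInvertible_mfderivWithin_extChartAt_symm (I := 𝓘(ℝ, E)) hy
  rw [ModelWithCorners.range_eq_univ, mfderivWithin_univ] at this
  exact this

/-- The value of a metric at `x`, as a bilinear form on the model space. -/
noncomputable def fiberForm (g : RiemannianMetric E M) (x : M) : E →L[ℝ] E →L[ℝ] ℝ := g.inner x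

/-- The metric in the chart around `p`, as a function with values in the bilinear forms. -/
noncomputable def chartForm (g : RiemannianMetric E M) (p : M) (y : E) : E →L[ℝ] E →L[ℝ] ℝ :=
  (fiberForm g ((extChartAt 𝓘(ℝ, E) p).symm y)).bilinearComp (chartDeriv p y) (chartDeriv p y)

variable (g : RiemannianMetric E M) {p q : M} {y : E}

theorem chartForm_apply (v w : E) : chartForm g p y v w =
    fiberForm g ((extChartAt 𝓘(ℝ, E) p).symm y) (chartDeriv p y v) (chartDeriv p y w) := rfl

theorem fiberForm_symm (x : M) (v w : E) : fiberForm g x v w = fiberForm g x w v :=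
  g.symm x v w

theorem fiberForm_pos (x : M) (v : E) (hv : v ≠ 0) : 0 < fiberForm g x v v :=
  g.pos x v hv

theorem chartForm_symm (v w : E) : chartForm g p y v w = chartForm g p y w v :=
  fiberForm_symm g _ _ _

theorem chartForm_pos (hy : y ∈ (extChartAt 𝓘(ℝ, E) p).target) (v : E) (hv : v ≠ 0) :
    0 < chartForm g p y v v := by
  refine fiberForm_pos g _ _ ?_
  obtain ⟨e, he⟩ := isInvertible_chartDeriv hy
  rw [← he]
  simpa using hv

theorem eventually_chartForm_pos (hy : y ∈ (extChartAt 𝓘(ℝ, E) p).target) :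
    ∀ᶠ z in 𝓝 y, ∀ v, v ≠ 0 → 0 < chartForm g p z v v :=
  mem_of_superset (target_mem_nhds hy) fun _ hz => chartForm_pos g hz

theorem contMDiffOn_chartField (p : M) (v : E) :
    ContMDiffOn 𝓘(ℝ, E) 𝓘(ℝ, E).tangent ∞
      (fun y => (⟨(extChartAt 𝓘(ℝ, E) p).symm y, chartDeriv p y v⟩ : TangentBundle 𝓘(ℝ, E) M))
      (extChartAt 𝓘(ℝ, E) p).target := by
  have h1 := (contMDiffOn_extChartAt_symm (I := 𝓘(ℝ, E)) (n := ∞) p).contMDiffOn_tangentMapWithin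
    (m := ∞) (by simp) (isOpen_target p).uniqueMDiffOn
  have h2 : ContMDiff 𝓘(ℝ, E) 𝓘(ℝ, E).tangent ∞
      (fun y : E => (⟨y, v⟩ : TangentBundle 𝓘(ℝ, E) E)) := by
    exact contMDiff_vectorSpace_iff_contDiff.2 contDiff_const
  refine (h1.comp (h2.contMDiffOn (s := (extChartAt 𝓘(ℝ, E) p).target)) (fun y hy => hy)).congr ?_
  intro y hy
  simp only [Function.comp_apply, tangentMapWithin]
  rw [mfderivWithin_of_isOpen (isOpen_target p) hy]
  rfl

theorem contDiffOn_chartForm [FiniteDimensional ℝ E] (p : M) :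
    ContDiffOn ℝ ∞ (chartForm g p) (extChartAt 𝓘(ℝ, E) p).target := by
  rw [contDiffOn_clm_apply]
  intro v
  rw [contDiffOn_clm_apply]
  intro w
  rw [← contMDiffOn_iff_contDiffOn]
  intro y hy
  have h1 : ContMDiffWithinAt 𝓘(ℝ, E) (𝓘(ℝ, E).prod 𝓘(ℝ)) ∞
      (fun y => Bundle.TotalSpace.mk' ℝ (E := Bundle.Trivial M ℝ) ((extChartAt 𝓘(ℝ, E) p).symm y)
        (g.inner ((extChartAt 𝓘(ℝ, E) p).symm y) (chartDeriv p y v) (chartDeriv p y w)))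
      (extChartAt 𝓘(ℝ, E) p).target y := by
    apply ContMDiffWithinAt.clm_bundle_apply₂ (F₁ := E) (F₂ := E)
    · exact g.contMDiff.contMDiffAt.comp_contMDiffWithinAt y (contMDiffOn_extChartAt_symm p y hy)
    · exact contMDiffOn_chartField p v y hy
    · exact contMDiffOn_chartField p w y hy
  rw [Bundle.contMDiffWithinAt_totalSpace] at h1
  exact h1.2

theorem contDiffAt_chartForm [FiniteDimensional ℝ E] (hy : y ∈ (extChartAt 𝓘(ℝ, E) p).target) :
    ContDiffAt ℝ ∞ (chartForm g p) y :=
  (contDiffOn_chartForm g p).contDiffAt (target_mem_nhds hy)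

/-- The change of coordinates from the chart around `q` to the chart around `p`. -/
noncomputable def transition (p q : M) (y : E) : E :=
  extChartAt 𝓘(ℝ, E) p ((extChartAt 𝓘(ℝ, E) q).symm y)

omit [IsManifold 𝓘(ℝ, E) ∞ M] in
theorem eventually_mem_source (hy : y ∈ (extChartAt 𝓘(ℝ, E) q).target)
    (hp : (extChartAt 𝓘(ℝ, E) q).symm y ∈ (extChartAt 𝓘(ℝ, E) p).source) :
    ∀ᶠ z in 𝓝 y, z ∈ (extChartAt 𝓘(ℝ, E) q).target ∧
      (extChartAt 𝓘(ℝ, E) q).symm z ∈ (extChartAt 𝓘(ℝ, E) p).source :=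
  Filter.Eventually.and (target_mem_nhds hy)
    ((continuousAt_extChartAt_symm'' hy).eventually
      ((isOpen_extChartAt_source p).mem_nhds hp))

theorem contDiffAt_transition (hy : y ∈ (extChartAt 𝓘(ℝ, E) q).target)
    (hp : (extChartAt 𝓘(ℝ, E) q).symm y ∈ (extChartAt 𝓘(ℝ, E) p).source) :
    ContDiffAt ℝ ∞ (transition p q) y := by
  rw [← contMDiffAt_iff_contDiffAt]
  exact (contMDiffAt_chart hp).comp y (contMDiffAt_symm hy)

theorem chartDeriv_transition (hy : y ∈ (extChartAt 𝓘(ℝ, E) q).target)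
    (hp : (extChartAt 𝓘(ℝ, E) q).symm y ∈ (extChartAt 𝓘(ℝ, E) p).source) (v : E) :
    chartDeriv q y v = chartDeriv p (transition p q y) (fderiv ℝ (transition p q) y v) := by
  have hpt : transition p q y ∈ (extChartAt 𝓘(ℝ, E) p).target := (extChartAt 𝓘(ℝ, E) p).map_source hp
  have h1 : (extChartAt 𝓘(ℝ, E) p).symm ∘ transition p q =ᶠ[𝓝 y] (extChartAt 𝓘(ℝ, E) q).symm :=
    (eventually_mem_source hy hp).mono fun z hz => (extChartAt 𝓘(ℝ, E) p).left_inv hz.2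
  have h2 : MDifferentiableAt 𝓘(ℝ, E) 𝓘(ℝ, E) (transition p q) y :=
    ((contDiffAt_transition hy hp).differentiableAt (by simp)).mdifferentiableAt
  have h3 := mfderiv_comp y (mdifferentiableAt_symm hpt) h2
  rw [h1.mfderiv_eq, mfderiv_eq_fderiv] at h3
  exact DFunLike.congr_fun h3 v

theorem chartForm_transition (hy : y ∈ (extChartAt 𝓘(ℝ, E) q).target)
    (hp : (extChartAt 𝓘(ℝ, E) q).symm y ∈ (extChartAt 𝓘(ℝ, E) p).source) (v w : E) :
    chartForm g q y v w = chartForm g p (transition p q y) (fderiv ℝ (transition p q) y v)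
      (fderiv ℝ (transition p q) y w) := by
  rw [chartForm_apply, chartForm_apply, chartDeriv_transition hy hp, chartDeriv_transition hy hp,
    transition, (extChartAt 𝓘(ℝ, E) p).left_inv hp]

end Charts

end GeodesicEquivalence

/-! ### The Euler-Lagrange equation and its invariance under coordinate changes. -/

section EulerLagrange
set_option maxSynthPendingDepth 3
open Filter Topology ContinuousLinearMap

variable {E : Type*} [NormedAddCommGroup E] [NormedSpace ℝ E]
  {G K : E → E →L[ℝ] E →L[ℝ] ℝ} {y : E} {u u' : ℝ → E} {t : ℝ}

/-- The Euler-Lagrange equation at time `t` of the geodesics of the metric `G`, for a curve `u` with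
velocity `u'`. -/
def EulerLagrangeAt (G : E → E →L[ℝ] E →L[ℝ] ℝ) (u u' : ℝ → E) (t : ℝ) : Prop :=
  ∀ w, HasDerivAt (fun s => G (u s) (u' s) w)
    ((1 / 2 : ℝ) * fderiv ℝ (fun y => G y (u' t) (u' t)) (u t) w) t

theorem hasFDerivAt_energy (hG : DifferentiableAt ℝ G y) (v : E) :
    HasFDerivAt (fun z => G z v v) (((fderiv ℝ G y).flip v).flip v) y :=
  (hG.hasFDerivAt.clm_apply (hasFDerivAt_const v y)).clm_apply (hasFDerivAt_const v y)
      |>.congr_fderiv (by ext; simp)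

theorem hasDerivAt_momentum {a u₁ : E} (hG : DifferentiableAt ℝ G (u t))
    (hu : HasDerivAt u u₁ t) (ha : HasDerivAt u' a t) :
    HasDerivAt (fun s => G (u s) (u' s)) (fderiv ℝ G (u t) u₁ (u' t) + G (u t) a) t := by
  have h0 : HasDerivAt (fun s => G (u s)) (fderiv ℝ G (u t) u₁) t :=
    hG.hasFDerivAt.comp_hasDerivAt t hu
  exact h0.clm_apply ha

theorem ContDiffAt.fderiv_fst {F : Type*} [NormedAddCommGroup F] [NormedSpace ℝ F]
    {f : E → F} (hf : ContDiffAt ℝ ∞ f y) (v : E) :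
    ContDiffAt ℝ 1 (fun z : E × E => fderiv ℝ f z.1) (y, v) :=
  ContDiffAt.comp (g := fderiv ℝ f) (y, v) (hf.fderiv_right (m := 1)
    (by rw [one_add_one_eq_two]; exact ENat.LEInfty.out)) contDiffAt_fst

theorem ContDiffAt.clm_flip {D F F' : Type*} [NormedAddCommGroup D] [NormedSpace ℝ D]
    [NormedAddCommGroup F] [NormedSpace ℝ F] [NormedAddCommGroup F'] [NormedSpace ℝ F']
    {c : D → E →L[ℝ] F →L[ℝ] F'} {d : D} (hc : ContDiffAt ℝ 1 c d) :
    ContDiffAt ℝ 1 (fun z => (c z).flip) d :=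
  ContDiffAt.comp (g := fun b : E →L[ℝ] F →L[ℝ] F' => b.flip) d
    (ContinuousLinearMap.flipₗᵢ ℝ E F F').toContinuousLinearEquiv.contDiff.contDiffAt hc

theorem spray_smul (c : ℝ) (v : E) : spray G y (c • v) = c ^ 2 • spray G y v := by
  rw [spray, spray, ← (G y).inverse.map_smul]
  congr 1
  ext w
  simp
  ring

variable [FiniteDimensional ℝ E]

/-- For twice differentiable curves the product rule isolates G(a, w), and positivity of G allows
solving for the acceleration a. -/
theorem eulerLagrangeAt_iff {a : E} (hG : DifferentiableAt ℝ G (u t))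
    (hp : ∀ v, v ≠ 0 → 0 < G (u t) v v)
    (hu : HasDerivAt u (u' t) t) (ha : HasDerivAt u' a t) :
    EulerLagrangeAt G u u' t ↔ a = spray G (u t) (u' t) := by
  have h1 : ∀ w, HasDerivAt (fun s => G (u s) (u' s) w)
      (fderiv ℝ G (u t) (u' t) (u' t) w + G (u t) a w) t := fun w =>
    ((hasDerivAt_momentum hG hu ha).clm_apply (hasDerivAt_const t w)).congr_deriv (by simp)
  have h2 := (hasFDerivAt_energy hG (u' t)).fderiv
  constructor
  · intro h
    have h3 : G (u t) a = G (u t) (spray G (u t) (u' t)) := by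
      ext w
      rw [apply_spray hp]
      have := (h w).unique (h1 w)
      rw [h2] at this
      simp only [flip_apply] at this
      linarith
    have := congrArg (G (u t)).inverse h3
    rwa [inverse_apply_of_posDef hp, inverse_apply_of_posDef hp] at this
  · rintro rfl w
    refine (h1 w).congr_deriv ?_
    rw [h2, apply_spray hp]
    simp

/-- The Euler-Lagrange equation is invariant under a change of coordinates `χ`. -/
theorem eulerLagrangeAt_of_pullback {c c' : ℝ → E} {χ : E → E}
    (hG : DifferentiableAt ℝ G (u t)) (hp : ∀ v, v ≠ 0 → 0 < G (u t) v v)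
    (hs : ∀ᶠ z in 𝓝 (u t), ∀ v w, G z v w = G z w v)
    (hχ : ContDiffAt ℝ ∞ χ (c t))
    (hK : ∀ᶠ z in 𝓝 (c t), ∀ v w, K z v w = G (χ z) (fderiv ℝ χ z v) (fderiv ℝ χ z w))
    (hu : ∀ᶠ s in 𝓝 t, HasDerivAt u (u' s) s) (hc : ∀ᶠ s in 𝓝 t, HasDerivAt c (c' s) s)
    (hcu : ∀ᶠ s in 𝓝 t, χ (c s) = u s)
    (ha : HasDerivAt u' (spray G (u t) (u' t)) t) : EulerLagrangeAt K c c' t := by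
  have hct := hc.self_of_nhds
  have hχ' : ContDiffAt ℝ 1 (fderiv ℝ χ) (c t) := hχ.fderiv_right (m := 1)
    (by rw [one_add_one_eq_two]; exact ENat.LEInfty.out)
  have hχ'd : DifferentiableAt ℝ (fderiv ℝ χ) (c t) := hχ'.differentiableAt (by simp)
  have hχd : ∀ᶠ z in 𝓝 (c t), DifferentiableAt ℝ χ z :=
    ((hχ.of_le (m := 1) (by simp)).eventually (by simp)).mono fun z hz =>
      hz.differentiableAt (by simp)
  have hvel : ∀ᶠ s in 𝓝 t, fderiv ℝ χ (c s) (c' s) = u' s := by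
    filter_upwards [hu, hc, hcu.eventually_nhds, hct.continuousAt.eventually hχd]
      with s h1 h2 h3 h4
    exact ((h4.hasFDerivAt.comp_hasDerivAt s h2).congr_of_eventuallyEq
      (EventuallyEq.symm h3)).unique h1
  have hut : χ (c t) = u t := hcu.self_of_nhds
  have hvt : fderiv ℝ χ (c t) (c' t) = u' t := hvel.self_of_nhds
  intro w
  -- The constant test vector w becomes the moving vector dχ(w), so a second derivative of χ appears
  -- on both sides of the equation.
  have hW : HasDerivAt (fun s => fderiv ℝ χ (c s) w) (fderiv ℝ (fderiv ℝ χ) (c t) (c' t) w) t :=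
    ((hχ'd.hasFDerivAt.comp_hasDerivAt t hct).clm_apply (hasDerivAt_const t w)).congr_deriv
      (by simp)
  have h1 := (hasDerivAt_momentum hG hu.self_of_nhds ha).clm_apply hW
  have h2 : (fun s => K (c s) (c' s) w) =ᶠ[𝓝 t] fun s => G (u s) (u' s) (fderiv ℝ χ (c s) w) := by
    filter_upwards [hvel, hcu, hct.continuousAt.eventually hK] with s h3 h4 h5
    rw [h5, h3, h4]
  refine (h1.congr_of_eventuallyEq h2).congr_deriv ?_
  have h3 : (fun z => K z (c' t) (c' t)) =ᶠ[𝓝 (c t)]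
      fun z => G (χ z) (fderiv ℝ χ z (c' t)) (fderiv ℝ χ z (c' t)) := hK.mono fun z hz => hz _ _
  rw [h3.fderiv_eq]
  have h4 : HasFDerivAt (fun z => fderiv ℝ χ z (c' t))
      ((fderiv ℝ (fderiv ℝ χ) (c t)).flip (c' t)) (c t) :=
    (hχ'd.hasFDerivAt.clm_apply (hasFDerivAt_const (c' t) (c t))).congr_fderiv (by ext; simp)
  have hG' : HasFDerivAt G (fderiv ℝ G (u t)) (χ (c t)) := by
    rw [hut]; exact hG.hasFDerivAt
  have h6 : HasFDerivAt (fun z => G (χ z)) (fderiv ℝ G (u t) ∘L fderiv ℝ χ (c t)) (c t) :=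
    hG'.comp (c t) hχd.self_of_nhds.hasFDerivAt
  have h7 := h6.clm_apply h4
  have h5 := (h7.clm_apply h4).fderiv
  rw [h5]
  -- Symmetry of the second derivative of χ makes these two extra terms agree.
  have hsymm : fderiv ℝ (fderiv ℝ χ) (c t) w (c' t) = fderiv ℝ (fderiv ℝ χ) (c t) (c' t) w :=
    (hχ.isSymmSndFDerivAt (by simpa using ENat.LEInfty.out)).eq w (c' t)
  simp only [add_apply, comp_apply, flip_apply, hvt, hut, hsymm]
  rw [apply_spray hp, hs.self_of_nhds (fderiv ℝ (fderiv ℝ χ) (c t) (c' t) w) (u' t)]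
  ring

end EulerLagrange

/-! ### Existence of geodesics and comparison of sprays. -/

namespace GeodesicEquivalence

section Geodesics
set_option maxSynthPendingDepth 3
open Filter Topology ContinuousLinearMap

variable {E : Type*} [NormedAddCommGroup E] [NormedSpace ℝ E] [FiniteDimensional ℝ E]
  {M : Type*} [TopologicalSpace M] [ChartedSpace E M] [IsManifold 𝓘(ℝ, E) ∞ M]

/-- Parametrised geodesics of a metric on a manifold modelled on `E`. -/
def IsGeodesic (g : RiemannianMetric E M) (γ : ℝ → M) (J : Set ℝ) : Prop :=
  ContMDiffOn 𝓘(ℝ, ℝ) 𝓘(ℝ, E) 2 γ J ∧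
  ∀ p : M, ∀ t ∈ J, γ t ∈ (extChartAt 𝓘(ℝ, E) p).source →
    EulerLagrangeAt (chartForm g p) (fun s => extChartAt 𝓘(ℝ, E) p (γ s))
      (deriv fun s => extChartAt 𝓘(ℝ, E) p (γ s)) t

/-- Every geodesic of `g` is a geodesic of `h` after a change of parameter. -/
def Reparametrizes (g h : RiemannianMetric E M) : Prop :=
  ∀ (γ : ℝ → M) (J : Set ℝ), IsOpen J → J.OrdConnected → IsGeodesic g γ J →
    ∃ (J' : Set ℝ) (φ : ℝ → ℝ), IsOpen J' ∧ J'.OrdConnected ∧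
      ContDiffOn ℝ 2 φ J' ∧ (∀ s ∈ J', deriv φ s ≠ 0) ∧ BijOn φ J' J ∧
      IsGeodesic h (γ ∘ φ) J'

variable (g h : RiemannianMetric E M) {p : M} {y : E}

theorem contDiffAt_spray {G : E → E →L[ℝ] E →L[ℝ] ℝ} (hG : ContDiffAt ℝ ∞ G y)
    (hp : ∀ v, v ≠ 0 → 0 < G y v v) (v : E) :
    ContDiffAt ℝ 1 (fun z : E × E => spray G z.1 z.2) (y, v) := by
  obtain ⟨e, he⟩ := isInvertible_of_posDef hp
  have h0 : ContDiffAt ℝ 1 (fun z : E × E => G z.1) (y, v) :=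
    ContDiffAt.comp (g := G) (y, v) (hG.of_le (by simp)) contDiffAt_fst
  have h1 : ContDiffAt ℝ 1 (ContinuousLinearMap.inverse (R := ℝ) (M := E) (M₂ := E →L[ℝ] ℝ))
      (G (y, v).1) := by
    rw [← he]
    exact contDiffAt_map_inverse e
  have h2 : ContDiffAt ℝ 1 (fun z : E × E => (G z.1).inverse) (y, v) :=
    ContDiffAt.comp (g := ContinuousLinearMap.inverse) (f := fun z : E × E => G z.1) (y, v) h1 h0
  have h3 := hG.fderiv_fst v
  have h4 : ContDiffAt ℝ 1 (fun z : E × E => z.2) (y, v) := contDiffAt_snd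
  exact h2.clm_apply ((((h3.clm_flip.clm_apply h4).clm_flip.clm_apply h4).const_smul
    (1 / 2 : ℝ)).sub ((h3.clm_apply h4).clm_apply h4))

/-- Existence of geodesics with a given initial position and velocity. -/
theorem exists_isGeodesic (hy : y ∈ (extChartAt 𝓘(ℝ, E) p).target) (v : E) :
    ∃ ε > (0 : ℝ), ∃ u u' : ℝ → E, u 0 = y ∧ u' 0 = v ∧
      (∀ t ∈ Ioo (-ε) ε, u t ∈ (extChartAt 𝓘(ℝ, E) p).target ∧ HasDerivAt u (u' t) t ∧
        HasDerivAt u' (spray (chartForm g p) (u t) (u' t)) t) ∧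
      IsGeodesic g (fun t => (extChartAt 𝓘(ℝ, E) p).symm (u t)) (Ioo (-ε) ε) := by
  obtain ⟨ε, hε, u, u', hu0, hu'0, hu2, hu⟩ := exists_solution_secondOrder
    (contDiffAt_spray (contDiffAt_chartForm g hy) (chartForm_pos g hy) v) (target_mem_nhds hy)
  refine ⟨ε, hε, u, u', hu0, hu'0, hu, ?_, ?_⟩
  · intro t ht
    exact ((contMDiffAt_symm (hu t ht).1).of_le ENat.LEInfty.out).comp_contMDiffWithinAt t
      (contMDiffOn_iff_contDiffOn.2 hu2 t ht)
  · intro q t ht hq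
    have hev : ∀ᶠ s in 𝓝 t, s ∈ Ioo (-ε) ε := isOpen_Ioo.mem_nhds ht
    obtain ⟨htt, hut, hu't⟩ := hu t ht
    have hsrc : ∀ᶠ s in 𝓝 t, (extChartAt 𝓘(ℝ, E) p).symm (u s) ∈ (extChartAt 𝓘(ℝ, E) q).source :=
      (hut.continuousAt.eventually (eventually_mem_source htt hq)).mono fun s hs => hs.2
    have hqt : transition q p (u t) ∈ (extChartAt 𝓘(ℝ, E) q).target :=
      (extChartAt 𝓘(ℝ, E) q).map_source hq
    have hqp : (extChartAt 𝓘(ℝ, E) q).symm (transition q p (u t)) ∈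
        (extChartAt 𝓘(ℝ, E) p).source := by
      rw [transition, (extChartAt 𝓘(ℝ, E) q).left_inv hq]
      exact (extChartAt 𝓘(ℝ, E) p).map_target htt
    have hback : ∀ s, u s ∈ (extChartAt 𝓘(ℝ, E) p).target →
        (extChartAt 𝓘(ℝ, E) p).symm (u s) ∈ (extChartAt 𝓘(ℝ, E) q).source →
        transition p q (transition q p (u s)) = u s := by
      intro s h1 h2
      rw [transition, transition, (extChartAt 𝓘(ℝ, E) q).left_inv h2,
        (extChartAt 𝓘(ℝ, E) p).right_inv h1]
    -- The differential equation was solved in one chart, whereas a geodesic must satisfy the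
    -- Euler-Lagrange equation in every chart.
    refine eulerLagrangeAt_of_pullback (G := chartForm g p) (u := u) (u' := u')
      (c := fun s => transition q p (u s)) (χ := transition p q)
      ((contDiffAt_chartForm g htt).differentiableAt (by simp)) (chartForm_pos g htt)
      (Eventually.of_forall fun z v w => chartForm_symm g v w) (contDiffAt_transition hqt hqp)
      ((eventually_mem_source hqt hqp).mono fun z hz v w => chartForm_transition g hz.1 hz.2 v w)
      (hev.mono fun s hs => (hu s hs).2.1) ?_ ?_ hu't
    · filter_upwards [hev, hsrc] with s h1 h2
      have h3 := (contDiffAt_transition (p := q) (hu s h1).1 h2).differentiableAt (by simp)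
      exact (h3.hasFDerivAt.comp_hasDerivAt s (hu s h1).2.1).differentiableAt.hasDerivAt
    · filter_upwards [hev, hsrc] with s h1 h2
      exact hback s (hu s h1).1 h2

/-- If the geodesics of `g` are reparametrised geodesics of `h`, then the sprays of the two metrics
differ by a multiple of the velocity. -/
theorem spray_sub_spray (hgh : Reparametrizes g h) (hy : y ∈ (extChartAt 𝓘(ℝ, E) p).target)
    (v : E) : ∃ σ : ℝ, spray (chartForm h p) y v - spray (chartForm g p) y v = σ • v := by
  obtain ⟨ε, hε, u, u', hu0, hu'0, hu, hgeo⟩ := exists_isGeodesic g hy v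
  have h0 : (0 : ℝ) ∈ Ioo (-ε) ε := ⟨by linarith, hε⟩
  obtain ⟨J', φ, hJ', -, hφ, hφ0, hbij, hgeo'⟩ := hgh _ _ isOpen_Ioo ordConnected_Ioo hgeo
  obtain ⟨s₀, hs₀, hφs₀⟩ := hbij.surjOn h0
  have hφd : ∀ s ∈ J', HasDerivAt φ (deriv φ s) s := fun s hs =>
    ((hφ.contDiffAt (hJ'.mem_nhds hs)).differentiableAt (by simp)).hasDerivAt
  have hφ2 : HasDerivAt (deriv φ) (deriv (deriv φ) s₀) s₀ := by
    rw [← one_add_one_eq_two, contDiffOn_succ_iff_deriv_of_isOpen hJ'] at hφ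
    exact ((hφ.2.2.contDiffAt (hJ'.mem_nhds hs₀)).differentiableAt (by simp)).hasDerivAt
  set c : ℝ → E := fun s => extChartAt 𝓘(ℝ, E) p
    (((fun t => (extChartAt 𝓘(ℝ, E) p).symm (u t)) ∘ φ) s) with hc
  have hcu : ∀ s ∈ J', c s = u (φ s) := fun s hs => by
    simp only [hc, Function.comp_apply]
    exact (extChartAt 𝓘(ℝ, E) p).right_inv (hu _ (hbij.mapsTo hs)).1
  have hev : ∀ᶠ s in 𝓝 s₀, s ∈ J' := hJ'.mem_nhds hs₀
  have hcd : ∀ s ∈ J', HasDerivAt c (deriv φ s • u' (φ s)) s := fun s hs => by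
    have h1 : HasDerivAt (fun s => u (φ s)) (deriv φ s • u' (φ s)) s :=
      (hu _ (hbij.mapsTo hs)).2.1.scomp s (hφd s hs)
    refine h1.congr_of_eventuallyEq ?_
    filter_upwards [hJ'.mem_nhds hs] with r hr using hcu r hr
  have hcd' : deriv c =ᶠ[𝓝 s₀] fun s => deriv φ s • u' (φ s) :=
    hev.mono fun s hs => (hcd s hs).deriv
  -- Acceleration of u ∘ φ: the square of φ' times the spray of g, plus φ'' v.
  have hc2 : HasDerivAt (deriv c) (deriv φ s₀ • deriv φ s₀ • spray (chartForm g p) y v +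
      deriv (deriv φ) s₀ • v) s₀ := by
    have h1 : HasDerivAt (fun s => u' (φ s))
        (deriv φ s₀ • spray (chartForm g p) (u (φ s₀)) (u' (φ s₀))) s₀ :=
      (hu _ (hbij.mapsTo hs₀)).2.2.scomp s₀ (hφd s₀ hs₀)
    rw [hφs₀, hu0, hu'0] at h1
    have h2 := hφ2.smul h1
    refine (h2.congr_of_eventuallyEq hcd').congr_deriv ?_
    rw [hφs₀, hu'0]
  have hcs₀ : c s₀ = y := by rw [hcu s₀ hs₀, hφs₀, hu0]
  have hsrc : ((fun t => (extChartAt 𝓘(ℝ, E) p).symm (u t)) ∘ φ) s₀ ∈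
      (extChartAt 𝓘(ℝ, E) p).source := by
    simp only [Function.comp_apply, hφs₀, hu0]
    exact (extChartAt 𝓘(ℝ, E) p).map_target hy
  have hEL := hgeo'.2 p s₀ hs₀ hsrc
  have hy' : c s₀ ∈ (extChartAt 𝓘(ℝ, E) p).target := by rw [hcs₀]; exact hy
  have hkey := (eulerLagrangeAt_iff ((contDiffAt_chartForm h hy').differentiableAt (by simp))
    (chartForm_pos h hy') ((hcd s₀ hs₀).differentiableAt.hasDerivAt) hc2).1 hEL
  rw [hcs₀, (hcd s₀ hs₀).deriv, hφs₀, hu'0, spray_smul] at hkey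
  have hne := hφ0 s₀ hs₀
  -- Since the spray is quadratic in the velocity, the equation of h reads φ'² S_g + φ'' v = φ'²
  -- S_h, whence σ = φ'' / φ'².
  refine ⟨(deriv φ s₀ ^ 2)⁻¹ * deriv (deriv φ) s₀, ?_⟩
  have h1 : spray (chartForm h p) y v =
      (deriv φ s₀ ^ 2)⁻¹ • (deriv φ s₀ ^ 2 • spray (chartForm h p) y v) := by
    rw [smul_smul, inv_mul_cancel₀ (pow_ne_zero 2 hne), one_smul]
  rw [h1, ← hkey, smul_add, smul_smul (deriv φ s₀) (deriv φ s₀), ← pow_two, smul_smul,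
    inv_mul_cancel₀ (pow_ne_zero 2 hne), one_smul, smul_smul]
  abel

end Geodesics

/-! ### Vector fields in charts and existence of flows on the manifold. -/

section Flows
set_option maxSynthPendingDepth 3
open Filter Topology ContinuousLinearMap

variable {E : Type*} [NormedAddCommGroup E] [NormedSpace ℝ E]
  {M : Type*} [TopologicalSpace M] [ChartedSpace E M]

/-- The derivative at `x` of the chart around `p`. -/
noncomputable def chartFwd (p : M) (x : M) : E →L[ℝ] E :=
  mfderiv 𝓘(ℝ, E) 𝓘(ℝ, E) (extChartAt 𝓘(ℝ, E) p) x

/-- The expression of a vector field in the chart around `p`. -/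
noncomputable def chartField (X : (x : M) → TangentSpace 𝓘(ℝ, E) x) (p : M) (y : E) : E :=
  (chartDeriv p y).inverse (X ((extChartAt 𝓘(ℝ, E) p).symm y))

/-- A `C¹` local flow of the vector field `X` on a manifold modelled on `E`. -/
structure IsFlow (X : (x : M) → TangentSpace 𝓘(ℝ, E) x) (a b : ℝ) (U : Set M)
    (θ : ℝ → M → M) : Prop where
  neg : a < 0
  pos : 0 < b
  isOpen : IsOpen U
  contMDiffOn : ContMDiffOn (𝓘(ℝ, ℝ).prod 𝓘(ℝ, E)) 𝓘(ℝ, E) 1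
    (fun z : ℝ × M => θ z.1 z.2) (Ioo a b ×ˢ U)
  map_zero : ∀ x ∈ U, θ 0 x = x
  integralCurve : ∀ x ∈ U, IsMIntegralCurveOn (I := 𝓘(ℝ, E)) (fun t => θ t x) X (Ioo a b)

variable [IsManifold 𝓘(ℝ, E) ∞ M] {p x : M} {y : E}

theorem chartDeriv_chartFwd (hx : x ∈ (extChartAt 𝓘(ℝ, E) p).source) (v : E) :
    chartDeriv p (extChartAt 𝓘(ℝ, E) p x) (chartFwd p x v) = v := by
  have h := mfderivWithin_extChartAt_symm_comp_mfderiv_extChartAt' (I := 𝓘(ℝ, E)) hx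
  rw [ModelWithCorners.range_eq_univ, mfderivWithin_univ] at h
  exact DFunLike.congr_fun h v

theorem chartFwd_chartDeriv (hx : x ∈ (extChartAt 𝓘(ℝ, E) p).source) (v : E) :
    chartFwd p x (chartDeriv p (extChartAt 𝓘(ℝ, E) p x) v) = v := by
  have h := mfderiv_extChartAt_comp_mfderivWithin_extChartAt_symm' (I := 𝓘(ℝ, E)) hx
  rw [ModelWithCorners.range_eq_univ, mfderivWithin_univ] at h
  exact DFunLike.congr_fun h v

theorem inverse_chartDeriv (hx : x ∈ (extChartAt 𝓘(ℝ, E) p).source) :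
    (chartDeriv p (extChartAt 𝓘(ℝ, E) p x)).inverse = chartFwd p x :=
  inverse_eq (by ext v; exact chartDeriv_chartFwd hx v) (by ext v; exact chartFwd_chartDeriv hx v)

variable {X : (x : M) → TangentSpace 𝓘(ℝ, E) x}

theorem chartField_apply (hx : x ∈ (extChartAt 𝓘(ℝ, E) p).source) :
    chartField X p (extChartAt 𝓘(ℝ, E) p x) = chartFwd (E := E) p x (X x) := by
  rw [chartField, inverse_chartDeriv hx, (extChartAt 𝓘(ℝ, E) p).left_inv hx]

theorem chartDeriv_chartField (hy : y ∈ (extChartAt 𝓘(ℝ, E) p).target) :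
    chartDeriv p y (chartField X p y) = X ((extChartAt 𝓘(ℝ, E) p).symm y) := by
  obtain ⟨e, he⟩ := isInvertible_chartDeriv hy
  rw [chartField, ← he, inverse_equiv]
  exact e.apply_symm_apply _

variable [CompleteSpace E]

theorem contDiffAt_chartField (hy : y ∈ (extChartAt 𝓘(ℝ, E) p).target)
    (hX : ContMDiff 𝓘(ℝ, E) 𝓘(ℝ, E).tangent ∞
      (fun x => (⟨x, X x⟩ : TangentBundle 𝓘(ℝ, E) M))) :
    ContDiffAt ℝ ∞ (chartField X p) y := by
  have h := ContMDiffAt.mpullback_vectorField_preimage (V := X) (m := ∞) (n := ∞)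
    (f := (extChartAt 𝓘(ℝ, E) p).symm) (x₀ := y) (hX _) (contMDiffAt_symm hy)
    (isInvertible_chartDeriv (E := E) hy) (by simp)
  exact contMDiffAt_vectorSpace_iff_contDiffAt.1 h

/-- Local flows of smooth vector fields exist. -/
theorem exists_isFlow (hX : ContMDiff 𝓘(ℝ, E) 𝓘(ℝ, E).tangent ∞
    (fun x => (⟨x, X x⟩ : TangentBundle 𝓘(ℝ, E) M))) (q : M) :
    ∃ (a b : ℝ) (U : Set M) (θ : ℝ → M → M), q ∈ U ∧ IsFlow X a b U θ := by
  have hq : q ∈ (extChartAt 𝓘(ℝ, E) q).source := mem_extChartAt_source q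
  have hqt := (extChartAt 𝓘(ℝ, E) q).map_source hq
  obtain ⟨ε, hε, V, hV, hqV, θ, hθ0, hθ, hθc⟩ := exists_contDiffOn_localFlow
    (contDiffAt_chartField hqt hX) (target_mem_nhds hqt)
  have hUo : IsOpen ((extChartAt 𝓘(ℝ, E) q).source ∩ extChartAt 𝓘(ℝ, E) q ⁻¹' V) :=
    (continuousOn_extChartAt q).isOpen_inter_preimage (isOpen_extChartAt_source q) hV
  refine ⟨-ε, ε, (extChartAt 𝓘(ℝ, E) q).source ∩ extChartAt 𝓘(ℝ, E) q ⁻¹' V, fun t x => (extChartAt 𝓘(ℝ, E) q).symm (θ t (extChartAt 𝓘(ℝ, E) q x)),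
    ⟨hq, hqV⟩, by linarith, hε, hUo, ?_, ?_, ?_⟩
  · rintro ⟨t, x⟩ ⟨ht, hxs, hxV⟩
    have h0 : (t, extChartAt 𝓘(ℝ, E) q x) ∈ Ioo (-ε) ε ×ˢ V := ⟨ht, hxV⟩
    have h1 : ContMDiffAt (𝓘(ℝ, ℝ).prod 𝓘(ℝ, E)) 𝓘(ℝ, ℝ × E) 1
        (fun z : ℝ × M => (z.1, extChartAt 𝓘(ℝ, E) q z.2)) (t, x) :=
      contMDiffAt_fst.prodMk_space
        (((contMDiffAt_chart hxs).of_le ENat.LEInfty.out).comp (t, x) contMDiffAt_snd)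
    have h2 : ContMDiffAt 𝓘(ℝ, ℝ × E) 𝓘(ℝ, E) 1 (fun z : ℝ × E => θ z.1 z.2)
        (t, extChartAt 𝓘(ℝ, E) q x) :=
      (hθc.contDiffAt ((isOpen_Ioo.prod hV).mem_nhds h0)).contMDiffAt
    have h3 : ContMDiffAt (𝓘(ℝ, ℝ).prod 𝓘(ℝ, E)) 𝓘(ℝ, E) 1
        (fun z : ℝ × M => θ z.1 (extChartAt 𝓘(ℝ, E) q z.2)) (t, x) := h2.comp (t, x) h1
    exact (((contMDiffAt_symm (hθ _ hxV t ht).1).of_le ENat.LEInfty.out).comp (t, x)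
      h3).contMDiffWithinAt
  · rintro x ⟨hxs, hxV⟩
    simp only [hθ0 _ hxV]
    exact (extChartAt 𝓘(ℝ, E) q).left_inv hxs
  · rintro x ⟨hxs, hxV⟩ t ht
    obtain ⟨h1, h2⟩ := hθ _ hxV t ht
    have h3 := (mdifferentiableAt_symm h1).hasMFDerivAt.comp t h2.hasFDerivAt.hasMFDerivAt
    refine (HasMFDerivAt.congr_mfderiv h3 (ContinuousLinearMap.ext fun c => ?_)).hasMFDerivWithinAt
    have h4 := chartDeriv_chartField (X := X) h1
    have h5 : ∀ c : ℝ, chartDeriv q (θ t (extChartAt 𝓘(ℝ, E) q x))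
        (c • chartField X q (θ t (extChartAt 𝓘(ℝ, E) q x))) =
        c • (X ((extChartAt 𝓘(ℝ, E) q).symm (θ t (extChartAt 𝓘(ℝ, E) q x))) : E) := by
      intro c
      rw [map_smul, h4]
      rfl
    exact h5 c

end Flows

/-! ### Flow invariance of a metric and vanishing of its Lie derivative. -/

section FlowDerivative
set_option maxSynthPendingDepth 3
open Filter Topology ContinuousLinearMap

variable {E : Type*} [NormedAddCommGroup E] [NormedSpace ℝ E]
  {M : Type*} [TopologicalSpace M] [ChartedSpace E M]

/-- The derivative of a map between manifolds, as a map of the model space. -/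
noncomputable def tangentDeriv (f : M → M) (x : M) : E →L[ℝ] E :=
  mfderiv 𝓘(ℝ, E) 𝓘(ℝ, E) f x

/-- The curve through `x` that is a straight line with velocity `v` in the chart around `x`. -/
noncomputable def chartLine (x : M) (v : E) (r : ℝ) : M :=
  (extChartAt 𝓘(ℝ, E) x).symm (extChartAt 𝓘(ℝ, E) x x + r • chartFwd x x v)

theorem chartLine_zero (x : M) (v : E) : chartLine x v 0 = x := by
  simp [chartLine]

variable [IsManifold 𝓘(ℝ, E) ∞ M] {q x : M}

theorem contMDiffAt_chartLine (x : M) (v : E) :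
    ContMDiffAt 𝓘(ℝ, ℝ) 𝓘(ℝ, E) ∞ (chartLine x v) 0 := by
  have h1 : ContDiffAt ℝ ∞ (fun r : ℝ => extChartAt 𝓘(ℝ, E) x x + r • chartFwd x x v) 0 := by
    fun_prop
  have h2 : extChartAt 𝓘(ℝ, E) x x + (0 : ℝ) • chartFwd x x v ∈
      (extChartAt 𝓘(ℝ, E) x).target := by
    simp
  exact (contMDiffAt_symm h2).comp (0 : ℝ) h1.contMDiffAt

/-- Representing tangent vectors by curves turns the time derivative of the differential of the flow
into a mixed partial derivative of a function of two real variables. -/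
theorem hasDerivAt_chart_comp_chartLine {f : M → M}
    (hf : MDifferentiableAt 𝓘(ℝ, E) 𝓘(ℝ, E) f x)
    (hq : f x ∈ (extChartAt 𝓘(ℝ, E) q).source) (v : E) :
    HasDerivAt (fun r => extChartAt 𝓘(ℝ, E) q (f (chartLine x v r)))
      (chartFwd q (f x) (tangentDeriv f x v)) 0 := by
  have h1 : HasDerivAt (fun r : ℝ => extChartAt 𝓘(ℝ, E) x x + r • chartFwd x x v)
      (chartFwd x x v) 0 := by
    simpa using ((hasDerivAt_id (0 : ℝ)).smul_const (chartFwd x x v)).const_add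
      (extChartAt 𝓘(ℝ, E) x x)
  have h2 : HasMFDerivAt 𝓘(ℝ, E) 𝓘(ℝ, E) (extChartAt 𝓘(ℝ, E) x).symm
      (extChartAt 𝓘(ℝ, E) x x + (0 : ℝ) • chartFwd x x v)
      (chartDeriv (E := E) x (extChartAt 𝓘(ℝ, E) x x)) := by
    have := (mdifferentiableAt_symm (E := E) (p := x) (mem_extChartAt_target x)).hasMFDerivAt
    rw [zero_smul, add_zero]
    exact this
  have h3 : HasMFDerivAt 𝓘(ℝ, ℝ) 𝓘(ℝ, E) (chartLine x v) 0
      ((chartDeriv x (extChartAt 𝓘(ℝ, E) x x)).comp (toSpanSingleton ℝ (chartFwd x x v))) :=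
    h2.comp (0 : ℝ) h1.hasFDerivAt.hasMFDerivAt
  have h4 : HasMFDerivAt 𝓘(ℝ, E) 𝓘(ℝ, E) f (chartLine x v 0)
      (tangentDeriv (E := E) f x) := by
    rw [chartLine_zero]
    exact hf.hasMFDerivAt
  have h5 : HasMFDerivAt 𝓘(ℝ, E) 𝓘(ℝ, E) (extChartAt 𝓘(ℝ, E) q) (f (chartLine x v 0))
      (chartFwd (E := E) q (f x)) := by
    rw [chartLine_zero]
    exact (mdifferentiableAt_chart hq).hasMFDerivAt
  have h6 : HasMFDerivAt 𝓘(ℝ, ℝ) 𝓘(ℝ, E) (fun r => extChartAt 𝓘(ℝ, E) q (f (chartLine x v r)))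
      (0 : ℝ) ((chartFwd (E := E) q (f x)).comp ((tangentDeriv f x).comp
      ((chartDeriv x (extChartAt 𝓘(ℝ, E) x x)).comp (toSpanSingleton ℝ (chartFwd x x v))))) :=
    h5.comp (0 : ℝ) (h4.comp (0 : ℝ) h3)
  have h7 : HasFDerivAt (fun r => extChartAt 𝓘(ℝ, E) q (f (chartLine x v r)))
      ((chartFwd (E := E) q (f x)).comp ((tangentDeriv f x).comp
      ((chartDeriv x (extChartAt 𝓘(ℝ, E) x x)).comp (toSpanSingleton ℝ (chartFwd x x v)))))
      (0 : ℝ) := hasMFDerivAt_iff_hasFDerivAt.1 h6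
  refine h7.hasDerivAt.congr_deriv ?_
  simp only [ContinuousLinearMap.comp_apply, toSpanSingleton_apply, one_smul,
    chartDeriv_chartFwd (mem_extChartAt_source (I := 𝓘(ℝ, E)) x)]

variable {X : (x : M) → TangentSpace 𝓘(ℝ, E) x} {a b t : ℝ} {U : Set M} {θ : ℝ → M → M}

omit [IsManifold 𝓘(ℝ, E) ∞ M] in
theorem IsFlow.contMDiffAt (hθ : IsFlow X a b U θ) (ht : t ∈ Ioo a b) (hx : x ∈ U) :
    ContMDiffAt (𝓘(ℝ, ℝ).prod 𝓘(ℝ, E)) 𝓘(ℝ, E) 1 (fun z : ℝ × M => θ z.1 z.2) (t, x) := by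
  have h : (t, x) ∈ Ioo a b ×ˢ U := ⟨ht, hx⟩
  exact hθ.contMDiffOn.contMDiffAt ((isOpen_Ioo.prod hθ.isOpen).mem_nhds h)

omit [IsManifold 𝓘(ℝ, E) ∞ M] in
theorem IsFlow.mdifferentiableAt (hθ : IsFlow X a b U θ) (ht : t ∈ Ioo a b) (hx : x ∈ U) :
    MDifferentiableAt 𝓘(ℝ, E) 𝓘(ℝ, E) (θ t) x := by
  have h : ContMDiffAt 𝓘(ℝ, E) 𝓘(ℝ, E) 1 (θ t) x :=
    ContMDiffAt.comp (g := fun z : ℝ × M => θ z.1 z.2) (f := fun x => (t, x)) x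
      (hθ.contMDiffAt ht hx) (contMDiffAt_const.prodMk contMDiffAt_id)
  exact h.mdifferentiableAt (by simp)

omit [IsManifold 𝓘(ℝ, E) ∞ M] in
theorem IsFlow.tangentDeriv_zero (hθ : IsFlow X a b U θ) (hx : x ∈ U) :
    tangentDeriv (θ 0) x = ContinuousLinearMap.id ℝ E := by
  have h1 : θ 0 =ᶠ[𝓝 x] id := mem_of_superset (hθ.isOpen.mem_nhds hx) hθ.map_zero
  have h2 := h1.mfderiv_eq (I := 𝓘(ℝ, E)) (I' := 𝓘(ℝ, E))
  rw [mfderiv_id] at h2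
  exact h2

theorem IsFlow.hasDerivAt_chart (hθ : IsFlow X a b U θ) (ht : t ∈ Ioo a b) (hx : x ∈ U)
    (hq : θ t x ∈ (extChartAt 𝓘(ℝ, E) q).source) :
    HasDerivAt (fun s => extChartAt 𝓘(ℝ, E) q (θ s x))
      (chartField X q (extChartAt 𝓘(ℝ, E) q (θ t x))) t := by
  have h1 := (hθ.integralCurve x hx t ht).hasMFDerivAt (Ioo_mem_nhds ht.1 ht.2)
  have h2 : HasMFDerivAt 𝓘(ℝ, E) 𝓘(ℝ, E) (extChartAt 𝓘(ℝ, E) q) (θ t x)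
      (chartFwd (E := E) q (θ t x)) := (mdifferentiableAt_chart hq).hasMFDerivAt
  have h3 : HasMFDerivAt 𝓘(ℝ, ℝ) 𝓘(ℝ, E) (fun s => extChartAt 𝓘(ℝ, E) q (θ s x)) t
      ((chartFwd (E := E) q (θ t x)).comp (toSpanSingleton ℝ (X (θ t x) : E))) := h2.comp t h1
  have h4 : HasFDerivAt (fun s => extChartAt 𝓘(ℝ, E) q (θ s x))
      ((chartFwd (E := E) q (θ t x)).comp (toSpanSingleton ℝ (X (θ t x) : E))) t :=
    hasMFDerivAt_iff_hasFDerivAt.1 h3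
  refine h4.hasDerivAt.congr_deriv ?_
  rw [chartField_apply hq]
  exact congrArg (chartFwd (E := E) q (θ t x)) (one_smul ℝ (X (θ t x) : E))

/-- The coordinate expression of a family of curves obtained by moving a curve along a flow. -/
theorem IsFlow.contDiffAt_variation (hθ : IsFlow X a b U θ) (ht : t ∈ Ioo a b) (hx : x ∈ U)
    (v : E) : ContDiffAt ℝ 1
      (fun z : ℝ × ℝ => extChartAt 𝓘(ℝ, E) (θ t x) (θ z.1 (chartLine x v z.2))) (t, 0) := by
  have h1 : ContMDiffAt 𝓘(ℝ, ℝ × ℝ) 𝓘(ℝ, E) 1 (fun z : ℝ × ℝ => chartLine x v z.2) (t, 0) :=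
    ContMDiffAt.comp (g := chartLine x v) (f := fun z : ℝ × ℝ => z.2) (t, (0 : ℝ))
      ((contMDiffAt_chartLine x v).of_le ENat.LEInfty.out) contDiffAt_snd.contMDiffAt
  have h2 : ContMDiffAt 𝓘(ℝ, ℝ × ℝ) (𝓘(ℝ, ℝ).prod 𝓘(ℝ, E)) 1
      (fun z : ℝ × ℝ => (z.1, chartLine x v z.2)) (t, 0) :=
    (contDiffAt_fst.contMDiffAt (𝕜 := ℝ) (E := ℝ × ℝ)).prodMk h1
  have h3 : ContMDiffAt 𝓘(ℝ, ℝ × ℝ) 𝓘(ℝ, E) 1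
      (fun z : ℝ × ℝ => θ z.1 (chartLine x v z.2)) (t, 0) := by
    refine ContMDiffAt.comp (g := fun z : ℝ × M => θ z.1 z.2) (t, (0 : ℝ)) ?_ h2
    simp only [chartLine_zero]
    exact hθ.contMDiffAt ht hx
  rw [← contMDiffAt_iff_contDiffAt]
  refine ContMDiffAt.comp (g := extChartAt 𝓘(ℝ, E) (θ t x)) (t, (0 : ℝ)) ?_ h3
  simp only [chartLine_zero]
  exact (contMDiffAt_chart (mem_extChartAt_source _)).of_le ENat.LEInfty.out

theorem IsFlow.eventually_mem (hθ : IsFlow X a b U θ) (ht : t ∈ Ioo a b) (hx : x ∈ U) (v : E) :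
    ∀ᶠ z : ℝ × ℝ in 𝓝 (t, 0), z.1 ∈ Ioo a b ∧ chartLine x v z.2 ∈ U ∧
      θ z.1 (chartLine x v z.2) ∈ (extChartAt 𝓘(ℝ, E) (θ t x)).source := by
  have h1 : ContinuousAt (fun z : ℝ × ℝ => chartLine x v z.2) (t, 0) :=
    ContinuousAt.comp (g := chartLine x v) (f := fun z : ℝ × ℝ => z.2) (x := (t, (0 : ℝ)))
      (contMDiffAt_chartLine x v).continuousAt continuousAt_snd
  have h2 : ContinuousAt (fun z : ℝ × ℝ => θ z.1 (chartLine x v z.2)) (t, 0) := by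
    refine ContinuousAt.comp (g := fun z : ℝ × M => θ z.1 z.2)
      (f := fun z : ℝ × ℝ => (z.1, chartLine x v z.2)) (x := (t, (0 : ℝ))) ?_
      (continuousAt_fst.prodMk h1)
    simp only [chartLine_zero]
    exact (hθ.contMDiffAt ht hx).continuousAt
  refine (continuousAt_fst.eventually (Ioo_mem_nhds ht.1 ht.2)).and
    ((h1.eventually (hθ.isOpen.mem_nhds ?_)).and
      (h2.eventually ((isOpen_extChartAt_source (θ t x)).mem_nhds ?_)))
  · simpa [chartLine_zero] using hx
  · simp [chartLine_zero]

variable [FiniteDimensional ℝ E] (g : RiemannianMetric E M)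

/-- The derivative of the pullback of a metric along the flow of `X` is the Lie derivative. -/
theorem IsFlow.hasDerivAt_fiberForm (hθ : IsFlow X a b U θ)
    (hX : ContMDiff 𝓘(ℝ, E) 𝓘(ℝ, E).tangent ∞ (fun x => (⟨x, X x⟩ : TangentBundle 𝓘(ℝ, E) M)))
    (ht : t ∈ Ioo a b) (hx : x ∈ U) (v : E) :
    HasDerivAt (fun s => fiberForm g (θ s x) (tangentDeriv (θ s) x v) (tangentDeriv (θ s) x v))
      (lieQuad (chartForm g (θ t x)) (chartField X (θ t x))
        (extChartAt 𝓘(ℝ, E) (θ t x) (θ t x))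
        (chartFwd (θ t x) (θ t x) (tangentDeriv (θ t) x v))) t := by
  have := FiniteDimensional.complete ℝ E
  set q := θ t x with hq
  have hqs : q ∈ (extChartAt 𝓘(ℝ, E) q).source := mem_extChartAt_source q
  have hqt := (extChartAt 𝓘(ℝ, E) q).map_source hqs
  have hm := hθ.eventually_mem ht hx v
  have hm0 : ∀ᶠ s in 𝓝 t, s ∈ Ioo a b ∧ θ s x ∈ (extChartAt 𝓘(ℝ, E) q).source := by
    have h : Tendsto (fun s : ℝ => (s, (0 : ℝ))) (𝓝 t) (𝓝 (t, 0)) :=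
      (continuous_id.prodMk continuous_const).tendsto' _ _ rfl
    filter_upwards [h.eventually hm] with s hs
    simp only [chartLine_zero] at hs
    exact ⟨hs.1, hs.2.2⟩
  have hσ0 : HasDerivAt (fun s => extChartAt 𝓘(ℝ, E) q (θ s x))
      (chartField X q (extChartAt 𝓘(ℝ, E) q (θ t x))) t := hθ.hasDerivAt_chart ht hx hqs
  have hXq := contDiffAt_chartField (p := q) hqt hX
  have hvar := hθ.contDiffAt_variation ht hx v
  have hD : ∀ᶠ s in 𝓝 t, HasDerivAt (fun r => extChartAt 𝓘(ℝ, E) q (θ s (chartLine x v r)))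
      (chartFwd q (θ s x) (tangentDeriv (θ s) x v)) 0 := hm0.mono fun s hs =>
    hasDerivAt_chart_comp_chartLine (hθ.mdifferentiableAt hs.1 hx) hs.2 v
  have hvs := hvar.hasStrictFDerivAt (by simp)
  have hXs : HasStrictFDerivAt (chartField X q) (fderiv ℝ (chartField X q)
      (extChartAt 𝓘(ℝ, E) q q)) (extChartAt 𝓘(ℝ, E) q (θ (t, (0 : ℝ)).1
        (chartLine x v (t, (0 : ℝ)).2))) := by
    simp only [chartLine_zero]
    exact hXq.hasStrictFDerivAt (by simp)
  have hZ := hXs.comp (t, (0 : ℝ)) hvs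
  -- The flow is only `C¹`, but its time derivative is the smooth field composed with the flow,
  -- hence strictly differentiable. This is all that interchanging the derivatives requires.
  have hpart := hasDerivAt_partial_comm
    (σ := fun s r => extChartAt 𝓘(ℝ, E) q (θ s (chartLine x v r)))
    (Z := fun s r => chartField X q (extChartAt 𝓘(ℝ, E) q (θ s (chartLine x v r))))
    (hm.mono fun z hz => hθ.hasDerivAt_chart hz.1 hz.2.1 hz.2.2) hD hZ
  have hDt : fderiv ℝ (fun z : ℝ × ℝ => extChartAt 𝓘(ℝ, E) q (θ z.1 (chartLine x v z.2))) (t, 0)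
      (0, 1) = chartFwd q q (tangentDeriv (θ t) x v) := by
    have h1 : HasDerivAt (fun r : ℝ => (t, r)) ((0 : ℝ), (1 : ℝ)) 0 :=
      (hasDerivAt_const (0 : ℝ) t).prodMk (hasDerivAt_id 0)
    have h2 := (hvar.differentiableAt (by simp)).hasFDerivAt.comp_hasDerivAt (0 : ℝ) h1
    exact h2.unique hD.self_of_nhds
  rw [ContinuousLinearMap.comp_apply, hDt] at hpart
  have hG : DifferentiableAt ℝ (chartForm g q) (extChartAt 𝓘(ℝ, E) q (θ t x)) :=
    (contDiffAt_chartForm g hqt).differentiableAt (by simp)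
  have hmom := (hasDerivAt_momentum hG hσ0 hpart).clm_apply hpart
  refine (hmom.congr_deriv ?_).congr_of_eventuallyEq (hm0.mono fun s hs => ?_)
  · rw [lieQuad, add_apply, chartForm_symm g (chartFwd q (θ t x) _)]
    ring
  · beta_reduce
    rw [chartForm_apply, chartDeriv_chartFwd hs.2, (extChartAt 𝓘(ℝ, E) q).left_inv hs.2]

/-- If the flow of `X` preserves `g`, then the Lie derivative of `g` along `X` vanishes. -/
theorem lieQuad_eq_zero_of_flow
    (hX : ContMDiff 𝓘(ℝ, E) 𝓘(ℝ, E).tangent ∞ (fun x => (⟨x, X x⟩ : TangentBundle 𝓘(ℝ, E) M)))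
    (hg : ∀ (a b : ℝ) (U : Set M) (θ : ℝ → M → M), IsFlow X a b U θ → ∀ t ∈ Ioo a b, ∀ x ∈ U,
      ∀ v : E, fiberForm g (θ t x) (tangentDeriv (θ t) x v) (tangentDeriv (θ t) x v) =
        fiberForm g x v v) (q : M) (w : E) :
    lieQuad (chartForm g q) (chartField X q) (extChartAt 𝓘(ℝ, E) q q) w = 0 := by
  have := FiniteDimensional.complete ℝ E
  obtain ⟨a, b, U, θ, hqU, hθ⟩ := exists_isFlow hX q
  have h0 : (0 : ℝ) ∈ Ioo a b := ⟨hθ.neg, hθ.pos⟩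
  have hqs : q ∈ (extChartAt 𝓘(ℝ, E) q).source := mem_extChartAt_source q
  -- The tangent vector is chosen to have coordinates w in the chart around q. Testing at the centre
  -- of each chart suffices, because every point is the centre of its own chart.
  have h1 := hθ.hasDerivAt_fiberForm g hX h0 hqU (chartDeriv q (extChartAt 𝓘(ℝ, E) q q) w)
  rw [hθ.tangentDeriv_zero hqU, hθ.map_zero q hqU, ContinuousLinearMap.id_apply, chartFwd_chartDeriv hqs] at h1
  refine h1.unique ((hasDerivAt_const (0 : ℝ) (fiberForm g q
    (chartDeriv q (extChartAt 𝓘(ℝ, E) q q) w)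
    (chartDeriv q (extChartAt 𝓘(ℝ, E) q q) w))).congr_of_eventuallyEq ?_)
  filter_upwards [Ioo_mem_nhds h0.1 h0.2] with s hs
  exact hg a b U θ hθ s hs q hqU _

/-- If the Lie derivative of `g` along `X` vanishes, then the flow of `X` preserves `g`. -/
theorem IsFlow.fiberForm_eq (hθ : IsFlow X a b U θ)
    (hX : ContMDiff 𝓘(ℝ, E) 𝓘(ℝ, E).tangent ∞ (fun x => (⟨x, X x⟩ : TangentBundle 𝓘(ℝ, E) M)))
    (hg : ∀ (q : M) (w : E),
      lieQuad (chartForm g q) (chartField X q) (extChartAt 𝓘(ℝ, E) q q) w = 0)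
    (ht : t ∈ Ioo a b) (hx : x ∈ U) (v w : E) :
    fiberForm g (θ t x) (tangentDeriv (θ t) x v) (tangentDeriv (θ t) x w) =
      fiberForm g x v w := by
  have h0 : (0 : ℝ) ∈ Ioo a b := ⟨hθ.neg, hθ.pos⟩
  have hquad : ∀ v : E, fiberForm g (θ t x) (tangentDeriv (θ t) x v) (tangentDeriv (θ t) x v) =
      fiberForm g x v v := by
    intro v
    have hd : ∀ s ∈ Ioo a b, HasDerivAt (fun s => fiberForm g (θ s x) (tangentDeriv (θ s) x v)
        (tangentDeriv (θ s) x v)) 0 s := fun s hs =>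
      (hθ.hasDerivAt_fiberForm g hX hs hx v).congr_deriv (hg _ _)
    have h := isOpen_Ioo.is_const_of_deriv_eq_zero isPreconnected_Ioo
      (fun s hs => (hd s hs).differentiableAt.differentiableWithinAt)
      (fun s hs => (hd s hs).deriv) ht h0
    rw [h, hθ.tangentDeriv_zero hx, hθ.map_zero x hx, ContinuousLinearMap.id_apply]
  -- Polarisation recovers the bilinear form from the quadratic one.
  have h := hquad (v + w)
  simp only [map_add, add_apply] at h
  have h1 := hquad v
  have h2 := hquad w
  have h3 := fiberForm_symm g (θ t x) (tangentDeriv (θ t) x v) (tangentDeriv (θ t) x w)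
  have h4 := fiberForm_symm g x v w
  linarith

end FlowDerivative

/-! ### The Knebelman field on the manifold. -/

section Transport
set_option maxSynthPendingDepth 3
open Filter Topology ContinuousLinearMap

variable {E : Type*} [NormedAddCommGroup E] [NormedSpace ℝ E] [FiniteDimensional ℝ E]

omit [FiniteDimensional ℝ E] in
theorem bilinearComp_pos {b : E →L[ℝ] E →L[ℝ] ℝ} (hb : ∀ v, v ≠ 0 → 0 < b v v) (e : E ≃L[ℝ] E)
    (v : E) (hv : v ≠ 0) : 0 < b.bilinearComp (e : E →L[ℝ] E) (e : E →L[ℝ] E) v v :=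
  hb _ (by simpa using hv)

theorem ratio_bilinearComp {b c : E →L[ℝ] E →L[ℝ] ℝ} (hb : ∀ v, v ≠ 0 → 0 < b v v)
    (e : E ≃L[ℝ] E) :
    ratio (b.bilinearComp (e : E →L[ℝ] E) (e : E →L[ℝ] E))
      (c.bilinearComp (e : E →L[ℝ] E) (e : E →L[ℝ] E)) =
      (e.symm : E →L[ℝ] E) ∘L ratio b c ∘L (e : E →L[ℝ] E) := by
  have hb' := bilinearComp_pos hb e
  ext v
  rw [← inverse_apply_of_posDef hb' (ratio _ _ v), apply_ratio hb',
    ← inverse_apply_of_posDef hb' (((e.symm : E →L[ℝ] E) ∘L ratio b c ∘L (e : E →L[ℝ] E)) v)]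
  congr 1
  ext w
  simp [apply_ratio hb]

/-- A change of basis conjugates the ratio operator, so its determinant does not change. The weight
is therefore a function on the manifold, although neither volume density is. -/
theorem weight_bilinearComp {b c : E →L[ℝ] E →L[ℝ] ℝ} (hb : ∀ v, v ≠ 0 → 0 < b v v)
    (e : E ≃L[ℝ] E) :
    weight (b.bilinearComp (e : E →L[ℝ] E) (e : E →L[ℝ] E))
      (c.bilinearComp (e : E →L[ℝ] E) (e : E →L[ℝ] E)) = weight b c := by
  rw [weight, weight, ratio_bilinearComp hb]
  congr 2
  exact LinearMap.det_conj (ratio b c : E →ₗ[ℝ] E) e.symm.toLinearEquiv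

variable {M : Type*} [TopologicalSpace M] [ChartedSpace E M] [IsManifold 𝓘(ℝ, E) ∞ M]
  (g h : RiemannianMetric E M) (X : (x : M) → TangentSpace 𝓘(ℝ, E) x) {p : M} {y : E}

/-- The vector field obtained from `X` by lowering its index with `g`, raising it with `h`, and
multiplying with a power of the ratio of the volume densities. -/
noncomputable def knebelman (x : M) : TangentSpace 𝓘(ℝ, E) x :=
  (weight (fiberForm h x) (fiberForm g x) • ratio (fiberForm h x) (fiberForm g x) (X x) : E)

theorem knebelman_ne_zero {x : M} (hx : X x ≠ 0) : knebelman g h X x ≠ 0 := by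
  have h1 : weight (fiberForm h x) (fiberForm g x) ≠ 0 :=
    (weight_pos (fiberForm_pos h x) (fiberForm_pos g x)).ne'
  have h2 : ratio (fiberForm h x) (fiberForm g x) (X x) ≠ 0 := by
    intro h0
    have h3 := apply_ratio (c := fiberForm g x) (fiberForm_pos h x) (X x : E)
    rw [h0, map_zero] at h3
    have h4 := fiberForm_pos g x (X x) hx
    rw [← h3] at h4
    exact lt_irrefl (0 : ℝ) h4
  exact smul_ne_zero h1 h2

theorem chartField_knebelman (hy : y ∈ (extChartAt 𝓘(ℝ, E) p).target) :
    chartField (knebelman g h X) p y = weight (chartForm h p y) (chartForm g p y) •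
      ratio (chartForm h p y) (chartForm g p y) (chartField X p y) := by
  obtain ⟨e, he⟩ := isInvertible_chartDeriv hy
  rw [chartField, chartField, chartForm, chartForm, ← he, inverse_equiv,
    weight_bilinearComp (fiberForm_pos h _), ratio_bilinearComp (fiberForm_pos h _)]
  have h1 : ∀ (c : ℝ) (A : E →L[ℝ] E) (v : E), (e.symm : E →L[ℝ] E) (c • A v) =
      c • ((e.symm : E →L[ℝ] E) ∘L A ∘L (e : E →L[ℝ] E)) ((e.symm : E →L[ℝ] E) v) := by
    simp
  exact h1 _ _ _

variable {X}

theorem contDiffAt_chartField_knebelman (hy : y ∈ (extChartAt 𝓘(ℝ, E) p).target)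
    (hX : ContMDiff 𝓘(ℝ, E) 𝓘(ℝ, E).tangent ∞
      (fun x => (⟨x, X x⟩ : TangentBundle 𝓘(ℝ, E) M))) :
    ContDiffAt ℝ ∞ (chartField (knebelman g h X) p) y := by
  have := FiniteDimensional.complete ℝ E
  have hG := contDiffAt_chartForm g hy
  have hH := contDiffAt_chartForm h hy
  have h1 := (ContDiffAt.weight hG hH (chartForm_pos g hy) (chartForm_pos h hy)).smul
    ((ContDiffAt.ratio hG hH (chartForm_pos h hy)).clm_apply (contDiffAt_chartField hy hX))
  exact h1.congr_of_eventuallyEq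
    (mem_of_superset (target_mem_nhds hy) fun z hz => chartField_knebelman g h X hz)

omit [FiniteDimensional ℝ E] in
-- Near p the section is the composite of the chart, the coordinate field, and the tangent map of
-- the inverse chart, all of them smooth.
theorem contMDiff_of_chartField {Y : (x : M) → TangentSpace 𝓘(ℝ, E) x}
    (hY : ∀ p : M, ContDiffAt ℝ ∞ (chartField Y p) (extChartAt 𝓘(ℝ, E) p p)) :
    ContMDiff 𝓘(ℝ, E) 𝓘(ℝ, E).tangent ∞ (fun x => (⟨x, Y x⟩ : TangentBundle 𝓘(ℝ, E) M)) := by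
  intro p
  have hps : p ∈ (extChartAt 𝓘(ℝ, E) p).source := mem_extChartAt_source p
  have hpt : extChartAt 𝓘(ℝ, E) p p ∈ (extChartAt 𝓘(ℝ, E) p).target :=
    (extChartAt 𝓘(ℝ, E) p).map_source hps
  have h1 := (contMDiffOn_extChartAt_symm (I := 𝓘(ℝ, E)) (n := ∞) p).contMDiffOn_tangentMapWithin
    (m := ∞) (by simp) (isOpen_target p).uniqueMDiffOn
  have h2 : ContMDiffAt 𝓘(ℝ, E) 𝓘(ℝ, E).tangent ∞
      (fun y : E => (⟨y, chartField (E := E) Y p y⟩ : TangentBundle 𝓘(ℝ, E) E))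
      (extChartAt 𝓘(ℝ, E) p p) :=
    contMDiffAt_vectorSpace_iff_contDiffAt.2 (hY p)
  have h3 := (h1 ⟨extChartAt 𝓘(ℝ, E) p p, chartField (E := E) Y p (extChartAt 𝓘(ℝ, E) p p)⟩
    hpt).comp (extChartAt 𝓘(ℝ, E) p p)
    (h2.contMDiffWithinAt (s := (extChartAt 𝓘(ℝ, E) p).target)) (fun y hy => hy)
  have h4 := (h3.contMDiffAt (target_mem_nhds hpt)).comp p (contMDiffAt_chart hps)
  refine h4.congr_of_eventuallyEq
    (mem_of_superset ((isOpen_extChartAt_source p).mem_nhds hps) fun x hx => ?_)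
  have hxt := (extChartAt 𝓘(ℝ, E) p).map_source hx
  have h5 := chartDeriv_chartField (X := Y) hxt
  rw [(extChartAt 𝓘(ℝ, E) p).left_inv hx] at h5
  -- The two base points are equal only propositionally; generalising over the second one avoids
  -- transporting the tangent vector.
  have h6 : ∀ (x' : M) (hx' : x' = x) (w : E), w = Y x →
      (⟨x, Y x⟩ : TangentBundle 𝓘(ℝ, E) M) = ⟨x', w⟩ := by
    rintro _ rfl w hw
    rw [hw]
  have h7 := mfderivWithin_of_isOpen (I := 𝓘(ℝ, E)) (I' := 𝓘(ℝ, E))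
    (f := (extChartAt 𝓘(ℝ, E) p).symm) (isOpen_target p) hxt
  exact h6 _ ((extChartAt 𝓘(ℝ, E) p).left_inv hx) _ ((DFunLike.congr_fun h7 _).trans h5)

theorem contMDiff_knebelman (hX : ContMDiff 𝓘(ℝ, E) 𝓘(ℝ, E).tangent ∞
      (fun x => (⟨x, X x⟩ : TangentBundle 𝓘(ℝ, E) M))) : ContMDiff 𝓘(ℝ, E) 𝓘(ℝ, E).tangent ∞
    (fun x => (⟨x, knebelman g h X x⟩ : TangentBundle 𝓘(ℝ, E) M)) :=
  contMDiff_of_chartField fun p =>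
    contDiffAt_chartField_knebelman g h (mem_extChartAt_target p) hX

/-- If `g` and `h` have the same unparametrised geodesics and the flow of `X` preserves `g`, then
the flow of `knebelman g h X` preserves `h`. -/
theorem IsFlow.fiberForm_eq_of_knebelman (hX : ContMDiff 𝓘(ℝ, E) 𝓘(ℝ, E).tangent ∞
      (fun x => (⟨x, X x⟩ : TangentBundle 𝓘(ℝ, E) M)))
    (hg : ∀ (a b : ℝ) (U : Set M) (θ : ℝ → M → M), IsFlow X a b U θ → ∀ t ∈ Ioo a b, ∀ x ∈ U,
      ∀ v : E, fiberForm g (θ t x) (tangentDeriv (θ t) x v) (tangentDeriv (θ t) x v) =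
        fiberForm g x v v)
    (hgh : Reparametrizes g h) {a b t : ℝ} {U : Set M} {θ : ℝ → M → M} {x : M}
    (hθ : IsFlow (knebelman g h X) a b U θ) (ht : t ∈ Ioo a b) (hx : x ∈ U) (v w : E) :
    fiberForm h (θ t x) (tangentDeriv (θ t) x v) (tangentDeriv (θ t) x w) =
      fiberForm h x v w := by
  have := FiniteDimensional.complete ℝ E
  refine hθ.fiberForm_eq h (contMDiff_knebelman g h hX) (fun q w => ?_) ht hx v w
  have hq : extChartAt 𝓘(ℝ, E) q q ∈ (extChartAt 𝓘(ℝ, E) q).target := mem_extChartAt_target q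
  have h1 := lieQuad_eq_zero (contDiffAt_chartForm g hq) (contDiffAt_chartForm h hq)
    (Eventually.of_forall fun z => chartForm_symm g) (eventually_chartForm_pos g hq)
    (Eventually.of_forall fun z => chartForm_symm h) (eventually_chartForm_pos h hq)
    (spray_sub_spray g h hgh hq) ((contDiffAt_chartField hq hX).differentiableAt (by simp))
    (lieQuad_eq_zero_of_flow g hX hg q) w
  -- The Lie derivative involves the first derivative of the field, so the coordinate formula is
  -- needed on a neighbourhood and not only at q.
  have h2 : chartField (knebelman g h X) q =ᶠ[𝓝 (extChartAt 𝓘(ℝ, E) q q)] fun z =>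
      weight (chartForm h q z) (chartForm g q z) •
        ratio (chartForm h q z) (chartForm g q z) (chartField X q z) :=
    mem_of_superset (target_mem_nhds hq) fun z hz => chartField_knebelman g h X hz
  rw [lieQuad, h2.fderiv_eq, h2.self_of_nhds]
  exact h1

end Transport

end GeodesicEquivalence

/-! ### The theorem, in the case of Euclidean model space. -/

theorem corollary7 (n : ℕ) {M : Type*} [TopologicalSpace M] [T2Space M]
    [ChartedSpace (EuclideanSpace ℝ (Fin n)) M] [IsManifold (𝓡 n) ∞ M]
    (g h : GeodesicEquivalence.Metric n M)
    (hgh : GeodesicEquivalence.GeodesicallyEquivalent g h)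
    (hg : ∃ X : (x : M) → TangentSpace (𝓡 n) x,
      GeodesicEquivalence.IsKilling g X ∧ ∃ x, X x ≠ 0) :
    ∃ Y : (x : M) → TangentSpace (𝓡 n) x,
      GeodesicEquivalence.IsKilling h Y ∧ ∃ x, Y x ≠ 0 := by
  obtain ⟨X, ⟨hX, hXg⟩, x, hx⟩ := hg
  have hflow : ∀ (Z : (x : M) → TangentSpace (𝓡 n) x) (a b : ℝ) (U : Set M) (θ : ℝ → M → M),
      GeodesicEquivalence.IsLocalFlow Z a b U θ ↔ GeodesicEquivalence.IsFlow Z a b U θ :=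
    fun Z a b U θ => ⟨fun h => ⟨h.1, h.2, h.3, h.4, h.5, h.6⟩,
      fun h => ⟨h.1, h.2, h.3, h.4, h.5, h.6⟩⟩
  -- `metricInChart` and `chartForm` agree by definition, so the two notions of geodesic and of
  -- reparametrisation coincide definitionally.
  have hrep : GeodesicEquivalence.Reparametrizes g h := hgh.1
  refine ⟨GeodesicEquivalence.knebelman g h X,
    ⟨GeodesicEquivalence.contMDiff_knebelman g h hX, ?_⟩, x,
    GeodesicEquivalence.knebelman_ne_zero g h X hx⟩
  intro a b U θ hθ t ht x hx v w
  exact GeodesicEquivalence.IsFlow.fiberForm_eq_of_knebelman g h hX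
    (fun a b U θ hθ t ht x hx v => hXg a b U θ ((hflow _ _ _ _ _).2 hθ) t ht x hx v v)
    hrep ((hflow _ _ _ _ _).1 hθ) ht hx v w
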